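/- Let $\mathbb{F}_q$ be the finite field with $q$ elements, $A=\mathbb{F}_q[T]$, $k=\mathbb{F}_q(T)$, and let $m\in A$ be monic. Let $\Lambda_m$ be the set of $m$-torsion points of the Carlitz module, that is, of the $A$-module structure on an algebraic closure of $k$ in which constants act by multiplication and $T\cdot x=Tx+x^q$. Let $K_m=k(\Lambda_m)$ be the $m$-th cyclotomic function field, and let $K_m^+$ be its maximal real subfield, i.e. the fixed field in $K_m$ of the group of those $\sigma\in\mathrm{Gal}(K_m/k)$ for which there is $c\in\mathbb{F}_q^\times$ with $\sigma(\lambda)=c\lambda$ for all $\lambda\in\Lambda_m$. Let $X_m$ be the finite set of primitive Dirichlet characters $\chi$ of $A$ with complex values whose conductor $f_\chi$ (a monic polynomial) divides $m$, where $\chi(a)=0$ if $a$ is not coprime to $f_\chi$. Let $X_m^+$ be the set of $\chi\in X_m$ with $\chi(c)=1$ for all $c\in\mathbb{F}_q^\times$, and put $X_m^-=X_m\setminus X_m^+$. Define $$J_m^{(-)}(X)=\prod_{\chi\in X_m^-}\ \prod_{Q\mid m}\bigl(1-\chi(Q)X^{\deg Q}\bigr)\in\mathbb{C}[X],$$ where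 here and below $Q$ runs through the monic irreducible polynomials dividing $m$. Then $$J_m^{(-)}(X)=\prod_{Q\mid m}\frac{(1-X^{f_Q\deg Q})^{g_Q}}{(1-X^{f_Q^+\deg Q})^{g_Q^+}}$$ in the field of rational functions $\mathbb{C}(X)$, where $f_Q,f_Q^+$ are the residue class degrees of $Q$ in $K_m/k$ and $K_m^+/k$, and $g_Q,g_Q^+$ are the numbers of primes above $Q$ in $K_m$ and $K_m^+$, respectively. In particular, $J_m^{(-)}(X)$ has integer coefficients, and $J_m^{(-)}(X)=1$ if $m$ is a power $P^n$ $(n\ge 1)$ of an irreducible polynomial $P$. -/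

import Mathlib

open Polynomial

noncomputable section

namespace CyclotomicFunctionField

/-! Throughout, `F` is the finite field with `q` elements, `F[X]` is the polynomial ring `A`
(the variable is the generator `T`), and `RatFunc F` is the rational function field `k`. -/

/-! ### The Carlitz module and cyclotomic function fields -/

section Carlitz

variable (F : Type*) [Field F] [Fintype F]

/-- The algebraic closure of the rational function field. -/
abbrev Kac : Type _ := AlgebraicClosure (RatFunc F)

/-- The `F`-linear endomorphism `φ + μ` of the algebraic closure, `x ↦ x ^ q + T * x`. -/
def carlitzT : Module.End F (Kac F) :=
  (FiniteField.frobeniusAlgHom F (Kac F)).toLinearMap +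
    LinearMap.mulLeft F (algebraMap (RatFunc F) (Kac F) RatFunc.X)

/-- The Carlitz action: a polynomial `a` acts on the algebraic closure through `a(φ + μ)`. -/
def carlitzAct (a : F[X]) : Module.End F (Kac F) := aeval (carlitzT F) a

variable {F}

theorem carlitzAct_C (c : F) (x : Kac F) : carlitzAct F (C c) x = c • x := by
  simp [carlitzAct, Module.algebraMap_end_apply]

/-- The set `Λ_m` of the `m`-torsion points of the Carlitz module. -/
def torsion (m : F[X]) : Set (Kac F) := {x | carlitzAct F m x = 0}

/-- The `m`-th cyclotomic function field `K_m = k(Λ_m)`. -/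
def cyclotomicField (m : F[X]) : IntermediateField (RatFunc F) (Kac F) :=
  IntermediateField.adjoin (RatFunc F) (torsion m)

/-- The subgroup of `Gal(K_m/k)` that corresponds to the subgroup `F_q^×` of `(A/(m))^×`:
the automorphisms which act on `Λ_m` as the Carlitz action of a nonzero constant. -/
def constantSubgroup (m : F[X]) :
    Subgroup (cyclotomicField m ≃ₐ[RatFunc F] cyclotomicField m) where
  carrier := {σ | ∃ c : Fˣ, ∀ x : cyclotomicField m, (x : Kac F) ∈ torsion m →
    ((σ x : cyclotomicField m) : Kac F) = carlitzAct F (C (c : F)) x}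
  one_mem' := ⟨1, fun x _ => by
    rw [carlitzAct_C, Units.val_one, one_smul, AlgEquiv.one_apply]⟩
  mul_mem' := by
    rintro σ τ ⟨c, hc⟩ ⟨d, hd⟩
    refine ⟨c * d, fun x hx => ?_⟩
    have h1 := hd x hx
    have h2 : ((τ x : cyclotomicField m) : Kac F) ∈ torsion m := by
      rw [h1, carlitzAct_C]
      simp only [torsion, Set.mem_ofPred_eq] at hx ⊢
      rw [map_smul, hx, smul_zero]
    have h3 := hc (τ x) h2
    rw [AlgEquiv.mul_apply, h3, h1, carlitzAct_C, carlitzAct_C, carlitzAct_C, Units.val_mul,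
      mul_smul]
  inv_mem' := by
    rintro σ ⟨c, hc⟩
    refine ⟨c⁻¹, fun x hx => ?_⟩
    have hy : carlitzAct F (C ((c⁻¹ : Fˣ) : F)) (x : Kac F) ∈ cyclotomicField m :=
      IntermediateField.subset_adjoin _ _ (by
        simp only [torsion, Set.mem_ofPred_eq] at hx ⊢
        rw [carlitzAct_C, map_smul, hx, smul_zero])
    have hs := hc ⟨_, hy⟩ (by
        simp only [torsion, Set.mem_ofPred_eq] at hx ⊢
        rw [carlitzAct_C, map_smul, hx, smul_zero])
    have h4 : σ ⟨_, hy⟩ = x := by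
      apply Subtype.ext
      rw [hs]
      simp [carlitzAct_C, smul_smul]
    have h5 : σ⁻¹ x = ⟨_, hy⟩ := (AlgEquiv.symm_apply_eq σ).2 h4.symm
    rw [h5]

/-- The maximal real subfield `K_m^+` of `K_m`: the subfield of `K_m` that corresponds
to `F_q^×`. -/
def maximalRealSubfield (m : F[X]) : IntermediateField (RatFunc F) (cyclotomicField m) :=
  IntermediateField.fixedField (constantSubgroup m)

end Carlitz

/-! ### Splitting of a prime of `A` in an extension of `k` -/

section Splitting

variable {F : Type*} [Field F]

/-- The residue class degree in `K/k` of a monic irreducible `Q`, read off from the primes above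
`Q` of the integral closure of `A` in `K`. (For `K/k` Galois all of them have the same degree.) -/
def residueDegree (K : Type*) [Field K] [Algebra F[X] K] (Q : F[X]) : ℕ :=
  (Ideal.span {Q}).inertiaDegIn (integralClosure F[X] K)

/-- The number of primes of `K` over `Q`. -/
def numPrimesOver (K : Type*) [Field K] [Algebra F[X] K] (Q : F[X]) : ℕ :=
  ((Ideal.span {Q}).primesOver (integralClosure F[X] K)).ncard

end Splitting

/-! ### Primitive Dirichlet characters -/

section Characters

variable {F : Type*} [Field F]

/-- A character of `(A/(f))^×` (extended by zero to `A/(f)`) is induced from modulus `d ∣ f` if it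
comes from a character of `(A/(d))^×` by reduction. -/
def IsInducedFrom {f : F[X]} (χ : MulChar (F[X] ⧸ Ideal.span {f}) ℂ) (d : F[X]) : Prop :=
  d ∣ f ∧ ∃ ψ : MulChar (F[X] ⧸ Ideal.span {d}) ℂ, ∀ a : F[X], IsCoprime a f →
    χ (Ideal.Quotient.mk _ a) = ψ (Ideal.Quotient.mk _ a)

variable (F) in
/-- A primitive Dirichlet character of `A`: a monic polynomial (its conductor) and a character
modulo the conductor that is not induced from a proper divisor of the conductor. -/
structure PrimitiveCharacter where
  conductor : F[X]
  monic : conductor.Monic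
  char : MulChar (F[X] ⧸ Ideal.span {conductor}) ℂ
  primitive : ∀ d : F[X], d.Monic → IsInducedFrom char d → d = conductor

/-- The value `χ(a)` of a primitive Dirichlet character, which is zero exactly if `a` is not
coprime to the conductor. -/
def PrimitiveCharacter.eval (χ : PrimitiveCharacter F) (a : F[X]) : ℂ :=
  χ.char (Ideal.Quotient.mk _ a)

/-- `X_m`: the primitive Dirichlet characters of `(A/(m))^×`, i.e. those whose conductor
divides `m`. -/
def charGroup (m : F[X]) : Set (PrimitiveCharacter F) := {χ | χ.conductor ∣ m}

/-- `X_m^+`: the characters in `X_m` that are trivial on `F_q^×`. -/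
def evenChars (m : F[X]) : Set (PrimitiveCharacter F) :=
  {χ ∈ charGroup m | ∀ c : F, c ≠ 0 → χ.eval (C c) = 1}

/-- `X_m^- = X_m - X_m^+`. -/
def oddChars (m : F[X]) : Set (PrimitiveCharacter F) := charGroup m \ evenChars m

/-- The monic irreducible polynomials dividing `m`. -/
def primeDivisors (m : F[X]) : Set F[X] := {Q | Q.Monic ∧ Irreducible Q ∧ Q ∣ m}

theorem primeDivisors_finite {m : F[X]} (hm : m ≠ 0) : (primeDivisors m).Finite := by
  have := Fintype.finite (Polynomial.fintypeSubtypeMonicDvd m hm)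
  have h : {d : F[X] | d.Monic ∧ d ∣ m}.Finite := this
  exact h.subset fun Q hQ => ⟨hQ.1, hQ.2.2⟩

theorem charGroup_finite [Finite F] {m : F[X]} (hm : m ≠ 0) : (charGroup m).Finite := by
  have := Fintype.finite (Polynomial.fintypeSubtypeMonicDvd m hm)
  have hfin (f : {d : F[X] // d.Monic ∧ d ∣ m}) :
      Finite (MulChar (F[X] ⧸ Ideal.span {(f : F[X])}) ℂ) := by
    have : Module.Finite F (F[X] ⧸ Ideal.span {(f : F[X])}) := f.2.1.finite_adjoinRoot
    have : Finite (F[X] ⧸ Ideal.span {(f : F[X])}) := Module.finite_of_finite F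
    infer_instance
  let g : charGroup m →
      Σ f : {d : F[X] // d.Monic ∧ d ∣ m}, MulChar (F[X] ⧸ Ideal.span {(f : F[X])}) ℂ :=
    fun χ => ⟨⟨χ.1.conductor, χ.1.monic, χ.2⟩, χ.1.char⟩
  have hg : Function.Injective g := by
    rintro ⟨⟨f, h1, χ, h2⟩, h3⟩ ⟨⟨f', h1', χ', h2'⟩, h3'⟩ h
    simp only [g, Sigma.mk.injEq, Subtype.mk.injEq] at h
    obtain ⟨rfl, h⟩ := h
    cases h
    rfl
  exact Finite.of_injective g hg

/-- `J_m^{(-)}(X)`, the product of the `1 - χ(Q) X ^ deg Q` over the `χ` in `X_m^-` and the monic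
irreducible divisors `Q` of `m`; both index sets are finite for monic `m`. -/
def JMinus (m : F[X]) : ℂ[X] :=
  ∏ᶠ χ ∈ oddChars m, ∏ᶠ Q ∈ primeDivisors m, (1 - C (χ.eval Q) * X ^ Q.natDegree)

end Characters

end CyclotomicFunctionField

end

/-! Both sides factor over the primes Q dividing m, so fix Q and write m = Q^(k+1) m' with Q not
dividing m'. Put B = (A/(m'))^×.

Analytic side. A character whose conductor is divisible by Q vanishes at Q and contributes 1; the
remaining characters in X_m are those of B. For b of order f in a finite abelian group B, the values
φ(b) run through the f-th roots of unity, each taken |B|/f times, so the product of 1 - φ(b)y over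
all φ is (1 - y^f)^(|B|/f). Even characters are the characters of B modulo the image U of F_q^×. The
odd factor is the full one divided by the even one (`finprod_mem_charGroup_eq`,
`finprod_one_sub_monoidHom_trivialOn`).

Arithmetic side. Let G = Gal(K_m/k) and let P lie over Q. The action on the m'-torsion gives ρ : G →
B. It is surjective, its kernel is the inertia group of P, and the decomposition group is the
preimage of the subgroup generated by the class of Q (`exists_galoisRep_decomposition`). Hence f_Q
is the order of Q in B and f_Q g_Q = |B|; for K_m^+ the same holds in B/U
(`splitting_cyclotomicField`). The exponents on the two sides therefore agree.

The structure of G is not presupposed; it comes from ramification (`inertia_structure`). Up to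
signs, Q is the product of the torsion points of exact order Q^(k+1), and all of these lie in P, so
the inertia group has at least as many elements as there are such points. It acts trivially on the
m'-torsion and so embeds into them. Thus both counts are equal, and every class prime to m is
realised by an automorphism (`exists_actsAs`).

Integrality follows because the denominators are monic up to sign. For a prime power m every odd
character vanishes at the only prime dividing m. -/

noncomputable section

namespace CyclotomicFunctionField

/-! ### Products over the characters of a finite abelian group -/

section GroupCharacters

/-- The product over the `n`-th roots of unity of `1 - z * y`. -/
theorem prod_rootsOfUnity_one_sub {R : Type*} [CommRing R] [IsDomain R] [Algebra ℂ R] (n : ℕ) (hn : 0 < n)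
    (y : R) : ∏ᶠ z : rootsOfUnity n ℂ, (1 - algebraMap ℂ R ((z : ℂˣ) : ℂ) * y) = 1 - y ^ n := by
  have : NeZero n := ⟨hn.ne'⟩
  have := Fintype.ofFinite (rootsOfUnity n ℂ)
  have hprim := Complex.isPrimitiveRoot_exp n hn.ne'
  have hR : IsPrimitiveRoot (algebraMap ℂ R (Complex.exp (2 * Real.pi * Complex.I / n))) n :=
    hprim.map_of_injective (FaithfulSMul.algebraMap_injective ℂ R)
  have h := hR.pow_sub_pow_eq_prod_sub_mul (1 : R) y hn
  rw [one_pow] at h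
  rw [h, finprod_eq_prod_of_fintype]
  refine Finset.prod_bij (fun z _ => algebraMap ℂ R ((z : ℂˣ) : ℂ)) ?_ ?_ ?_ ?_
  · intro z _
    rw [Polynomial.mem_nthRootsFinset hn, ← map_pow, ← Units.val_pow_eq_pow_val]
    have := z.2
    rw [mem_rootsOfUnity] at this
    rw [this]; simp
  · intro a _ b _ hab
    exact Subtype.ext (Units.ext (FaithfulSMul.algebraMap_injective ℂ R hab))
  · intro b hb
    rw [Polynomial.mem_nthRootsFinset hn] at hb
    obtain ⟨i, _, hi⟩ := hR.eq_pow_of_pow_eq_one hb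
    refine ⟨(hprim.toRootsOfUnity) ^ i, Finset.mem_univ _, ?_⟩
    rw [← hi]
    simp
  · intro a _; rfl

/-- The product of `1 - φ(b) y` over all complex characters `φ` of a finite commutative group. -/
theorem finprod_one_sub_monoidHom {R : Type*} [CommRing R] [IsDomain R] [Algebra ℂ R]
    {B : Type*} [CommGroup B] [Finite B] (b : B) (y : R) :
    ∏ᶠ φ : B →* ℂˣ, (1 - algebraMap ℂ R (φ b : ℂ) * y) =
      (1 - y ^ orderOf b) ^ (Nat.card B / orderOf b) := by
  classical
  have hfin : Finite (B →* ℂˣ) := Nat.finite_of_card_ne_zero (by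
    rw [CommGroup.card_monoidHom_of_hasEnoughRootsOfUnity B ℂ]; exact Nat.card_pos.ne')
  have := Fintype.ofFinite (B →* ℂˣ)
  have hpos : 0 < orderOf b := orderOf_pos b
  let ev : (B →* ℂˣ) →* rootsOfUnity (orderOf b) ℂ :=
    { toFun := fun φ => ⟨φ b, by rw [mem_rootsOfUnity, ← map_pow, pow_orderOf_eq_one, map_one]⟩
      map_one' := rfl
      map_mul' := fun _ _ => rfl }
  have : NeZero (orderOf b) := ⟨hpos.ne'⟩
  have := Fintype.ofFinite (rootsOfUnity (orderOf b) ℂ)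
  have hcardr : Nat.card (rootsOfUnity (orderOf b) ℂ) = orderOf b := by
    rw [Complex.card_rootsOfUnity]
  -- If N is the order of the image, then φ(b)^N = 1 for all φ. Characters separate points, so b^N =
  -- 1 and the order of b divides N.
  have hsurj : Function.Surjective ev := by
    rw [← MonoidHom.range_eq_top]
    apply Subgroup.eq_top_of_le_card
    rw [hcardr]
    refine Nat.le_of_dvd Nat.card_pos (orderOf_dvd_of_pow_eq_one ?_)
    rw [← CommGroup.forall_apply_eq_apply_iff B (M := ℂ)]
    intro φ
    have := pow_card_eq_one' (x := (⟨ev φ, ⟨φ, rfl⟩⟩ : ev.range))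
    have h2 := congrArg (fun z : ev.range => ((z : rootsOfUnity (orderOf b) ℂ) : ℂˣ)) this
    simpa [ev] using h2
  have hfib : ∀ z, (Finset.univ.filter (fun φ => ev φ = z)).card = Nat.card B / orderOf b := by
    intro z
    have hsum := Finset.card_eq_sum_card_fiberwise (f := ev) (s := Finset.univ) (t := Finset.univ)
      (fun _ _ => Finset.mem_coe.2 (Finset.mem_univ _))
    have hc : ∀ w ∈ (Finset.univ : Finset (rootsOfUnity (orderOf b) ℂ)),
        (Finset.univ.filter (fun φ => ev φ = w)).card =
          (Finset.univ.filter (fun φ => ev φ = z)).card := fun w _ =>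
      MonoidHom.card_fiber_eq_of_mem_range ev (hsurj w) (hsurj z)
    rw [Finset.sum_congr rfl hc, Finset.sum_const, smul_eq_mul, Finset.card_univ, Finset.card_univ,
      ← Nat.card_eq_fintype_card, ← Nat.card_eq_fintype_card, hcardr,
      CommGroup.card_monoidHom_of_hasEnoughRootsOfUnity B ℂ] at hsum
    rw [hsum, Nat.mul_div_cancel_left _ hpos]
  rw [finprod_eq_prod_of_fintype]
  have h1 : ∏ φ : B →* ℂˣ, (1 - algebraMap ℂ R (φ b : ℂ) * y) =
      ∏ φ : B →* ℂˣ, (fun z : rootsOfUnity (orderOf b) ℂ =>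
        (1 - algebraMap ℂ R ((z : ℂˣ) : ℂ) * y)) (ev φ) := rfl
  rw [h1, ← Finset.prod_fiberwise' Finset.univ ev
    (fun z : rootsOfUnity (orderOf b) ℂ => (1 - algebraMap ℂ R ((z : ℂˣ) : ℂ) * y))]
  simp_rw [Finset.prod_const, hfib]
  rw [Finset.prod_pow, ← prod_rootsOfUnity_one_sub _ hpos, finprod_eq_prod_of_fintype]

/-- The product of `1 - φ(b) y` over all complex characters `φ` of a finite commutative group
that are trivial on a given subgroup. -/
theorem finprod_one_sub_monoidHom_trivialOn {R : Type*} [CommRing R] [IsDomain R] [Algebra ℂ R]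
    {B : Type*} [CommGroup B] [Finite B] (U : Subgroup B) (b : B) (y : R) :
    ∏ᶠ φ ∈ {φ : B →* ℂˣ | ∀ u ∈ U, φ u = 1}, (1 - algebraMap ℂ R (φ b : ℂ) * y) =
      (1 - y ^ orderOf (b : B ⧸ U)) ^ (Nat.card (B ⧸ U) / orderOf (b : B ⧸ U)) := by
  rw [← finprod_one_sub_monoidHom, ← finprod_mem_univ (fun φ : B ⧸ U →* ℂˣ => _)]
  symm
  refine finprod_mem_eq_of_bijOn (fun φ : B ⧸ U →* ℂˣ => φ.comp (QuotientGroup.mk' U)) ⟨?_, ?_, ?_⟩ ?_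
  · intro φ _ u hu
    have : (QuotientGroup.mk' U) u = 1 := (QuotientGroup.eq_one_iff u).2 hu
    simp only [MonoidHom.comp_apply, this, map_one]
  · intro φ _ ψ _ h
    ext x
    exact congrArg Units.val (DFunLike.congr_fun h x)
  · intro φ hφ
    refine ⟨QuotientGroup.lift U φ (fun u hu => hφ u hu), Set.mem_univ _, ?_⟩
    ext x; rfl
  · intro φ _; rfl

end GroupCharacters

/-! ### Primitive characters and characters of unit groups of residue rings -/

section PrimitiveCharacters

variable {F : Type*} [Field F]

/-- The multiplication of `F[X] ⧸ (n)`, coming from its commutative ring structure. Instance search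
would otherwise use a structure that agrees with it only after unfolding. -/
instance (n : F[X]) : Monoid (F[X] ⧸ Ideal.span {n}) :=
  (Ideal.Quotient.commRing _).toCommMonoid.toMonoid

theorem isUnit_mk_iff_isCoprime {n a : F[X]} :
    IsUnit (Ideal.Quotient.mk (Ideal.span {n}) a) ↔ IsCoprime a n := by
  constructor
  · intro h
    obtain ⟨b, hb⟩ := h.exists_right_inv
    obtain ⟨b, rfl⟩ := Ideal.Quotient.mk_surjective b
    rw [← map_mul, ← map_one (Ideal.Quotient.mk (Ideal.span {n})), Ideal.Quotient.eq,
      Ideal.mem_span_singleton] at hb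
    obtain ⟨c, hc⟩ := hb
    exact ⟨b, -c, by linear_combination hc⟩
  · rintro ⟨u, v, h⟩
    refine IsUnit.of_mul_eq_one (Ideal.Quotient.mk _ u) ?_
    rw [← map_mul, ← map_one (Ideal.Quotient.mk (Ideal.span {n})), Ideal.Quotient.eq,
      Ideal.mem_span_singleton]
    exact ⟨-v, by linear_combination h⟩

/-- The class of a polynomial coprime to the modulus, as a unit. -/
def unitMk {n a : F[X]} (h : IsCoprime a n) : (F[X] ⧸ Ideal.span {n})ˣ :=
  (isUnit_mk_iff_isCoprime.2 h).unit

@[simp]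
theorem coe_unitMk {n a : F[X]} (h : IsCoprime a n) :
    ((unitMk h : (F[X] ⧸ Ideal.span {n})ˣ) : F[X] ⧸ Ideal.span {n}) = Ideal.Quotient.mk _ a := rfl

theorem exists_eq_unitMk {n : F[X]} (u : (F[X] ⧸ Ideal.span {n})ˣ) :
    ∃ (a : F[X]) (h : IsCoprime a n), u = unitMk h := by
  obtain ⟨a, ha⟩ := Ideal.Quotient.mk_surjective (u : F[X] ⧸ Ideal.span {n})
  exact ⟨a, isUnit_mk_iff_isCoprime.1 (ha ▸ u.isUnit), Units.ext ha.symm⟩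

/-- A residue class coprime to a divisor `d` of `n` has a representative coprime to `n`. -/
theorem exists_isCoprime_dvd_sub {d n a : F[X]} (hn : n ≠ 0) (h : IsCoprime a d) :
    ∃ b, IsCoprime b n ∧ d ∣ b - a := by
  classical
  -- The representative is a + d ∏ S. A prime Q of n divides exactly one of the two summands: if Q
  -- divides a, it divides neither d nor ∏ S; otherwise it divides ∏ S.
  let S := (UniqueFactorizationMonoid.normalizedFactors n).toFinset.filter (fun Q => ¬ Q ∣ a)
  have hS : ∀ Q : F[X], Prime Q → Q ∣ n → (Q ∣ ∏ P ∈ S, P ↔ ¬ Q ∣ a) := by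
    intro Q hQ hQn
    constructor
    · intro hd
      obtain ⟨P, hP, hQP⟩ := (Prime.dvd_finsetProd_iff hQ _).1 hd
      rw [Finset.mem_filter, Multiset.mem_toFinset] at hP
      have hPp := UniqueFactorizationMonoid.prime_of_normalized_factor P hP.1
      exact fun hQa => hP.2 ((hQ.associated_of_dvd hPp hQP).dvd_iff_dvd_left.1 hQa)
    · intro hQa
      obtain ⟨P, hP, hQP⟩ :=
        UniqueFactorizationMonoid.exists_mem_normalizedFactors_of_dvd hn hQ.irreducible hQn
      refine hQP.dvd.trans (Finset.dvd_prod_of_mem (fun P => P) ?_)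
      rw [Finset.mem_filter, Multiset.mem_toFinset]
      exact ⟨hP, fun h => hQa (hQP.dvd.trans h)⟩
  refine ⟨a + d * ∏ P ∈ S, P, ?_, ⟨∏ P ∈ S, P, by ring⟩⟩
  refine isCoprime_of_prime_dvd (fun h => hn h.2) fun Q hQ hQb hQn => ?_
  by_cases hQa : Q ∣ a
  · have h1 := (dvd_add_right hQa).1 hQb
    rcases hQ.dvd_or_dvd h1 with h2 | h2
    · exact hQ.not_isUnit (h.isUnit_of_dvd' hQa h2)
    · exact (hS Q hQ hQn).1 h2 hQa
  · have h2 := (hS Q hQ hQn).2 hQa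
    exact hQa ((dvd_add_left (h2.mul_left d)).1 hQb)

/-- The reduction map between unit groups of residue rings. -/
def unitsRed {d n : F[X]} (h : d ∣ n) : (F[X] ⧸ Ideal.span {n})ˣ →* (F[X] ⧸ Ideal.span {d})ˣ :=
  Units.map (Ideal.Quotient.factor (Ideal.span_singleton_le_span_singleton.2 h)).toMonoidHom

theorem unitsRed_unitMk {d n a : F[X]} (h : d ∣ n) (ha : IsCoprime a n) :
    unitsRed h (unitMk ha) = unitMk (ha.of_isCoprime_of_dvd_right h) := by
  ext; rfl

theorem unitsRed_surjective {d n : F[X]} (h : d ∣ n) (hn : n ≠ 0) :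
    Function.Surjective (unitsRed h) := by
  intro u
  obtain ⟨a, ha, rfl⟩ := exists_eq_unitMk u
  obtain ⟨b, hb, hd⟩ := exists_isCoprime_dvd_sub hn ha
  refine ⟨unitMk hb, ?_⟩
  rw [unitsRed_unitMk]
  ext
  rw [coe_unitMk, coe_unitMk, Ideal.Quotient.eq, Ideal.mem_span_singleton]
  exact hd

/-- The hypothesis makes χ trivial on the kernel of the reduction of unit groups, which is
surjective, so χ factors through it. -/
theorem isInducedFrom_of_forall {f d : F[X]} (χ : MulChar (F[X] ⧸ Ideal.span {f}) ℂ) (hd : d ∣ f)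
    (hf : f ≠ 0)
    (h : ∀ a, IsCoprime a f → d ∣ a - 1 → χ (Ideal.Quotient.mk _ a) = 1) :
    IsInducedFrom χ d := by
  refine ⟨hd, MulChar.ofUnitHom ((unitsRed hd).liftOfSurjective (unitsRed_surjective hd hf)
    ⟨χ.toUnitHom, ?_⟩), ?_⟩
  · intro u hu
    obtain ⟨a, ha, rfl⟩ := exists_eq_unitMk u
    rw [MonoidHom.mem_ker, unitsRed_unitMk] at hu
    rw [MonoidHom.mem_ker]
    ext
    rw [MulChar.coe_toUnitHom, coe_unitMk, Units.val_one]
    refine h a ha ?_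
    have := congrArg Units.val hu
    rwa [coe_unitMk, Units.val_one, ← map_one (Ideal.Quotient.mk (Ideal.span {d})),
      Ideal.Quotient.eq, Ideal.mem_span_singleton] at this
  · intro a ha
    have h1 : Ideal.Quotient.mk (Ideal.span {d}) a =
      ((unitsRed hd (unitMk ha) : (F[X] ⧸ Ideal.span {d})ˣ) : F[X] ⧸ Ideal.span {d}) := by
      rw [unitsRed_unitMk]; rfl
    rw [h1, MulChar.ofUnitHom_coe, MonoidHom.liftOfSurjective,
      MonoidHom.liftOfRightInverse_comp_apply, MulChar.coe_toUnitHom, coe_unitMk]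

theorem PrimitiveCharacter.eval_of_not_isCoprime (χ : PrimitiveCharacter F) {a : F[X]}
    (h : ¬ IsCoprime a χ.conductor) : χ.eval a = 0 :=
  χ.char.map_nonunit (fun hu => h (isUnit_mk_iff_isCoprime.1 hu))

theorem PrimitiveCharacter.eval_eq_of_dvd_sub (χ : PrimitiveCharacter F) {a b : F[X]}
    (h : χ.conductor ∣ a - b) : χ.eval a = χ.eval b := by
  unfold PrimitiveCharacter.eval
  rw [(Ideal.Quotient.eq).2 (Ideal.mem_span_singleton.2 h)]

theorem PrimitiveCharacter.eval_one (χ : PrimitiveCharacter F) : χ.eval 1 = 1 := by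
  unfold PrimitiveCharacter.eval
  rw [map_one, map_one]

/-- Every character of `(A/(n))ˣ` is induced from a primitive character whose conductor
divides `n`. -/
theorem exists_primitiveCharacter {n : F[X]} (hn : n.Monic)
    (ψ : MulChar (F[X] ⧸ Ideal.span {n}) ℂ) :
    ∃ χ : PrimitiveCharacter F, χ.conductor ∣ n ∧
      ∀ a, IsCoprime a n → χ.eval a = ψ (Ideal.Quotient.mk _ a) := by
  classical
  -- The conductor is a modulus of least degree from which ψ is induced; inducing further down would
  -- contradict minimality.
  have hex : ∃ k, ∃ d : F[X], d.Monic ∧ d.natDegree = k ∧ IsInducedFrom ψ d :=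
    ⟨_, n, hn, rfl, dvd_rfl, ψ, fun _ _ => rfl⟩
  obtain ⟨d, hd, hk, hdn, χ, hχ⟩ := Nat.find_spec hex
  refine ⟨⟨d, hd, χ, ?_⟩, hdn, fun a ha => (hχ a ha).symm⟩
  rintro e he ⟨hed, χ', hχ'⟩
  refine (Polynomial.eq_of_monic_of_dvd_of_natDegree_le he hd hed ?_).symm
  rw [hk]
  refine Nat.find_min' hex ⟨e, he, rfl, hed.trans hdn, χ', fun a ha => ?_⟩
  rw [hχ a ha, hχ' a (ha.of_isCoprime_of_dvd_right hdn)]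

/-- By primitivity it suffices that χ₁ is induced from the gcd of the conductors f₁ and f₂. If a is
1 modulo the gcd, Bézout gives an element congruent to a modulo f₁ and to 1 modulo f₂. A
representative b of its class modulo f₁f₂ that is coprime to n satisfies χ₁(a) = χ₁(b) = χ₂(b) =
χ₂(1) = 1. -/
theorem PrimitiveCharacter.conductor_dvd_of_eval_eq {n : F[X]} (hn : n ≠ 0)
    {χ₁ χ₂ : PrimitiveCharacter F}
    (h : ∀ a, IsCoprime a n → χ₁.eval a = χ₂.eval a) : χ₁.conductor ∣ χ₂.conductor := by
  classical
  set f₁ := χ₁.conductor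
  set f₂ := χ₂.conductor
  set g₀ := EuclideanDomain.gcd f₁ f₂
  have hf₁ : f₁ ≠ 0 := χ₁.monic.ne_zero
  have hg₀ : g₀ ≠ 0 := fun h0 => hf₁ (EuclideanDomain.gcd_eq_zero_iff.1 h0).1
  have hass : Associated (normalize g₀) g₀ := normalize_associated g₀
  have hg₁ : normalize g₀ ∣ f₁ := hass.dvd.trans (EuclideanDomain.gcd_dvd_left _ _)
  have hg₂ : normalize g₀ ∣ f₂ := hass.dvd.trans (EuclideanDomain.gcd_dvd_right _ _)
  suffices hind : IsInducedFrom χ₁.char (normalize g₀) from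
    (χ₁.primitive (normalize g₀) (Polynomial.monic_normalize hg₀) hind).symm.dvd.trans hg₂
  refine isInducedFrom_of_forall _ hg₁ hf₁ fun a ha hda => ?_
  obtain ⟨w, hw⟩ := hass.symm.dvd.trans hda
  have hbez : g₀ = f₁ * _ + f₂ * _ := EuclideanDomain.gcd_eq_gcd_ab f₁ f₂
  set u := EuclideanDomain.gcdA f₁ f₂
  set v := EuclideanDomain.gcdB f₁ f₂
  have e1 : a - f₁ * (u * w) = 1 + f₂ * (v * w) := by
    rw [hbez] at hw; linear_combination hw
  have hc : IsCoprime (a - f₁ * (u * w)) (f₁ * f₂) := by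
    refine IsCoprime.mul_right ?_ ?_
    · rw [sub_eq_add_neg, ← mul_neg]
      exact ha.add_mul_left_left _
    · rw [e1]
      exact isCoprime_one_left.add_mul_left_left _
  obtain ⟨b, hb, hdb⟩ := exists_isCoprime_dvd_sub hn hc
  have hb1 : χ₁.eval b = χ₁.eval a := χ₁.eval_eq_of_dvd_sub (by
    obtain ⟨s, hs⟩ := hdb
    exact ⟨f₂ * s - u * w, by linear_combination hs⟩)
  have hb2 : χ₂.eval b = χ₂.eval 1 := χ₂.eval_eq_of_dvd_sub (by
    obtain ⟨s, hs⟩ := hdb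
    exact ⟨f₁ * s + v * w, by linear_combination hs + e1⟩)
  change χ₁.eval a = 1
  rw [← hb1, h b hb, hb2, χ₂.eval_one]

/-- A primitive character is determined by its values at the polynomials coprime to a multiple
of its conductor. -/
theorem PrimitiveCharacter.eq_of_eval_eq {n : F[X]} (hn : n ≠ 0)
    {χ₁ χ₂ : PrimitiveCharacter F}
    (h : ∀ a, IsCoprime a n → χ₁.eval a = χ₂.eval a) : χ₁ = χ₂ := by
  have hcond : χ₁.conductor = χ₂.conductor :=
    Polynomial.eq_of_monic_of_associated χ₁.monic χ₂.monic (associated_of_dvd_dvd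
      (conductor_dvd_of_eval_eq hn h)
      (conductor_dvd_of_eval_eq hn fun a ha => (h a ha).symm))
  obtain ⟨f₁, m₁, c₁, p₁⟩ := χ₁
  obtain ⟨f₂, m₂, c₂, p₂⟩ := χ₂
  obtain rfl : f₁ = f₂ := hcond
  have : c₁ = c₂ := by
    refine MulChar.ext fun u => ?_
    obtain ⟨a, ha, rfl⟩ := exists_eq_unitMk u
    obtain ⟨b, hb, hd⟩ := exists_isCoprime_dvd_sub hn ha
    have e : Ideal.Quotient.mk (Ideal.span {f₁}) a = Ideal.Quotient.mk _ b :=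
      (Ideal.Quotient.eq.2 (Ideal.mem_span_singleton.2 hd)).symm
    rw [coe_unitMk, e]
    exact h b hb
  subst this
  rfl

/-- The classes of the nonzero constants modulo `n`. -/
def constantUnits (n : F[X]) : Subgroup (F[X] ⧸ Ideal.span {n})ˣ :=
  (Units.map ((Ideal.Quotient.mk (Ideal.span {n})).comp C).toMonoidHom).range

theorem isCoprime_C_left {c : F} (hc : c ≠ 0) (n : F[X]) : IsCoprime (C c) n :=
  (isCoprime_one_left (x := n)).of_isCoprime_of_dvd_left
    (Polynomial.isUnit_C.2 hc.isUnit).dvd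

/-- Reindexing a product over primitive characters by the characters of `(A/(n))ˣ`. -/
theorem finprod_mem_charGroup_eq {n a : F[X]} (hn : n.Monic) (ha : IsCoprime a n)
    {M : Type*} [CommMonoid M] (f : ℂ → M)
    (U : Subgroup (F[X] ⧸ Ideal.span {n})ˣ) (s : Set (PrimitiveCharacter F))
    (hs : ∀ χ, χ ∈ s ↔ χ.conductor ∣ n ∧
      ∀ b (hb : IsCoprime b n), unitMk hb ∈ U → χ.eval b = 1) :
    ∏ᶠ χ ∈ s, f (χ.eval a) =
      ∏ᶠ φ ∈ {φ : (F[X] ⧸ Ideal.span {n})ˣ →* ℂˣ | ∀ u ∈ U, φ u = 1},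
        f (φ (unitMk ha) : ℂ) := by
  have hex : ∀ φ : (F[X] ⧸ Ideal.span {n})ˣ →* ℂˣ, ∃ χ : PrimitiveCharacter F,
      χ.conductor ∣ n ∧ ∀ b (hb : IsCoprime b n), χ.eval b = (φ (unitMk hb) : ℂ) := by
    intro φ
    obtain ⟨χ, h1, h2⟩ := exists_primitiveCharacter hn (MulChar.ofUnitHom φ)
    refine ⟨χ, h1, fun b hb => ?_⟩
    rw [h2 b hb, ← coe_unitMk hb, MulChar.ofUnitHom_coe]
  choose g hg1 hg2 using hex
  symm
  refine finprod_mem_eq_of_bijOn g ⟨?_, ?_, ?_⟩ ?_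
  · intro φ hφ
    refine (hs _).2 ⟨hg1 φ, fun b hb hbU => ?_⟩
    rw [hg2 φ b hb, hφ _ hbU, Units.val_one]
  · intro φ _ ψ _ h
    ext u
    obtain ⟨b, hb, rfl⟩ := exists_eq_unitMk u
    rw [← hg2 φ b hb, h, hg2 ψ b hb]
  · intro χ hχ
    obtain ⟨hd, hU⟩ := (hs χ).1 hχ
    have key : ∀ b (hb : IsCoprime b n),
        ((χ.char.toUnitHom.comp (unitsRed hd) (unitMk hb) : ℂˣ) : ℂ) = χ.eval b := by
      intro b hb
      rw [MonoidHom.comp_apply, unitsRed_unitMk, MulChar.coe_toUnitHom, coe_unitMk]; rfl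
    refine ⟨χ.char.toUnitHom.comp (unitsRed hd), ?_, ?_⟩
    · intro u hu
      obtain ⟨b, hb, rfl⟩ := exists_eq_unitMk u
      ext
      rw [key, hU b hb hu, Units.val_one]
    · refine PrimitiveCharacter.eq_of_eval_eq hn.ne_zero fun b hb => ?_
      rw [hg2 _ b hb, key]
  · intro φ _
    rw [hg2 φ a ha]

/-- Gives X_n the same shape as its even part, with the trivial subgroup in place of the constants,
so that one computation serves both. -/
theorem mem_charGroup_iff_trivialOn_bot {n : F[X]} (χ : PrimitiveCharacter F) :
    χ ∈ charGroup n ↔ χ.conductor ∣ n ∧ ∀ b (hb : IsCoprime b n),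
      unitMk hb ∈ (⊥ : Subgroup (F[X] ⧸ Ideal.span {n})ˣ) → χ.eval b = 1 := by
  refine ⟨fun h => ⟨h, fun b hb h1 => ?_⟩, fun h => h.1⟩
  rw [Subgroup.mem_bot] at h1
  have := congrArg Units.val h1
  rw [coe_unitMk, Units.val_one, ← map_one (Ideal.Quotient.mk (Ideal.span {n})),
      Ideal.Quotient.eq, Ideal.mem_span_singleton] at this
  rw [χ.eval_eq_of_dvd_sub (dvd_trans h this), χ.eval_one]

theorem mem_evenChars_iff_trivialOn_constantUnits {n : F[X]} (χ : PrimitiveCharacter F) :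
    χ ∈ evenChars n ↔ χ.conductor ∣ n ∧ ∀ b (hb : IsCoprime b n),
      unitMk hb ∈ constantUnits n → χ.eval b = 1 := by
  refine and_congr_right fun h => ?_
  constructor
  · rintro h1 b hb ⟨c, hc⟩
    rw [← h1 c c.ne_zero]
    refine χ.eval_eq_of_dvd_sub (dvd_trans h ?_)
    rw [← Ideal.mem_span_singleton, ← Ideal.Quotient.eq]
    exact (congrArg Units.val hc).symm
  · intro h1 c hc
    refine h1 _ (isCoprime_C_left hc n) ⟨Units.mk0 c hc, ?_⟩
    ext; rfl

/-- Characters whose conductor is divisible by `Q` contribute trivially to the product at `Q`. -/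
theorem finprod_mem_mul_pow_eq {R : Type*} [CommRing R] [Algebra ℂ R] {Q m' : F[X]} {k : ℕ}
    (y : R) (p : PrimitiveCharacter F → Prop) :
    ∏ᶠ χ ∈ {χ : PrimitiveCharacter F | χ ∈ charGroup (Q ^ k * m') ∧ p χ},
        (1 - algebraMap ℂ R (χ.eval Q) * y) =
      ∏ᶠ χ ∈ {χ : PrimitiveCharacter F | χ ∈ charGroup m' ∧ p χ},
        (1 - algebraMap ℂ R (χ.eval Q) * y) := by
  refine finprod_mem_inter_mulSupport_eq _ _ _ ?_
  ext χ
  simp only [Set.mem_inter_iff, Set.mem_ofPred_eq, Function.mem_mulSupport]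
  refine and_congr_left fun h => and_congr_left fun _ => ?_
  -- A factor other than 1 means χ(Q) ≠ 0, so the conductor is prime to Q, and then the factor Q^k
  -- does not affect divisibility.
  have hc : IsCoprime Q χ.conductor := by
    by_contra hc
    rw [χ.eval_of_not_isCoprime hc] at h
    simp at h
  exact ⟨fun h1 => (hc.symm.pow_right).dvd_of_dvd_mul_left h1, fun h1 => dvd_mul_of_dvd_right h1 _⟩

end PrimitiveCharacters

/-! ### Decomposition and inertia groups in an abelian tower -/

section HilbertTheory

theorem card_comap_eq {G Γ : Type*} [Group G] [Group Γ] (ρ : G →* Γ) (Z : Subgroup Γ) :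
    Nat.card (Z.comap ρ) = Nat.card ρ.ker * Nat.card (ρ.range ⊓ Z : Subgroup Γ) := by
  have hle : ρ.ker ≤ Z.comap ρ := MonoidHom.ker_le_comap ρ Z
  rw [← (ρ.ker.subgroupOf (Z.comap ρ)).card_mul_index,
    Nat.card_congr (Subgroup.subgroupOfEquivOfLe hle).toEquiv]
  congr 1
  change ρ.ker.relIndex _ = _
  rw [Subgroup.relIndex_ker, Subgroup.map_comap_eq]

theorem card_eq_card_ker_mul_card_range {G Γ : Type*} [Group G] [Group Γ] (ρ : G →* Γ) :
    Nat.card G = Nat.card ρ.ker * Nat.card ρ.range := by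
  rw [← ρ.ker.card_mul_index, Subgroup.index_ker]

/-- The map ⟨γ⟩ → ⟨γU⟩ is onto with kernel U ∩ ⟨γ⟩. -/
theorem orderOf_mk_mul_card {Γ : Type*} [CommGroup Γ] (U : Subgroup Γ) (γ : Γ) :
    orderOf (γ : Γ ⧸ U) * Nat.card (U ⊓ Subgroup.zpowers γ : Subgroup Γ) = orderOf γ := by
  rw [← Nat.card_zpowers (γ : Γ ⧸ U), ← Nat.card_zpowers γ]
  have hm : Subgroup.zpowers (γ : Γ ⧸ U) = (Subgroup.zpowers γ).map (QuotientGroup.mk' U) := by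
    rw [MonoidHom.map_zpowers]; rfl
  rw [hm, ← Subgroup.relIndex_ker, QuotientGroup.ker_mk', mul_comm,
    ← (U.subgroupOf (Subgroup.zpowers γ)).card_mul_index, Subgroup.relIndex]
  congr 1
  rw [← Subgroup.inf_subgroupOf_right]
  exact (Nat.card_congr (Subgroup.subgroupOfEquivOfLe inf_le_right).toEquiv).symm

open Ideal
open scoped Pointwise

variable {A B C G : Type*} [CommRing A] [CommRing B] [CommRing C] [IsDomain C]
  [Algebra A B] [Algebra A C] [Algebra B C] [IsScalarTower A B C] [FaithfulSMul A B]
  [FaithfulSMul B C]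
  [Group G] [Finite G] [MulSemiringAction G C] [IsGaloisGroup G A C]

/-- Residue degree and number of primes in the fixed ring `B` of a subgroup `H` of an abelian
Galois group, in terms of a homomorphism `ρ` whose kernel is the inertia group and for which the
decomposition group is the preimage of the subgroup generated by `γ`. -/
theorem inertiaDegIn_and_ncard_of_stabilizer_eq (N : Type*) [Group N] [Finite N]
    [MulSemiringAction N B] [IsGaloisGroup N A B] (H : Subgroup G) [IsGaloisGroup H B C]
    (p : Ideal A) [p.IsPrime] (P : Ideal C) [P.IsPrime] [P.LiesOver p]
    [PerfectField p.ResidueField] [PerfectField (P.under B).ResidueField]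
    {Γ : Type*} [CommGroup Γ] [Finite Γ] (ρ : G →* Γ) (hρ : Function.Surjective ρ)
    (γ : Γ) (hI : P.inertia G = ρ.ker)
    (hD : MulAction.stabilizer G P = (Subgroup.zpowers γ).comap ρ) :
    p.inertiaDegIn B = orderOf (γ : Γ ⧸ H.map ρ) ∧
      p.inertiaDegIn B * (p.primesOver B).ncard = Nat.card (Γ ⧸ H.map ρ) := by
  have hover : (P.under B).LiesOver p := P.under_liesOver_of_liesOver B p
  have hne : Nonempty ((P.under B).primesOver C) := ⟨⟨P, ‹_›, ⟨rfl⟩⟩⟩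
  set U := H.map ρ with hU
  set ρH : H →* Γ := ρ.comp H.subtype with hρH
  have hrange : ρH.range = U := by
    rw [hρH, MonoidHom.range_comp, Subgroup.range_subtype]
  have hIH : P.inertia H = ρH.ker := by
    ext σ
    rw [← Ideal.coe_mem_inertia, hI]; rfl
  have hDH : MulAction.stabilizer H P = (Subgroup.zpowers γ).comap ρH := by
    ext σ
    have : (σ : G) ∈ MulAction.stabilizer G P ↔ (σ : G) ∈ (Subgroup.zpowers γ).comap ρ := by
      rw [hD]
    exact this
  -- Group orders give the invariants of C/A (through G) and of C/B (through H); those of B/A follow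
  -- by cancelling in these tower formulas.
  have fB := inertiaDegIn_mul_inertiaDegIn p (P.under B) N C G H
  have gB := ncard_primesOver_mul_ncard_primesOver (p := p) (P.under B) N C G
  have fC : orderOf γ = p.inertiaDegIn C := by
    have h1 := card_stabilizer_eq_card_inertia_mul_finrank (G := G) p P
    rw [← inertiaDegIn_eq_inertiaDeg p P G, hI, hD, card_comap_eq,
      MonoidHom.range_eq_top.2 hρ, top_inf_eq, Nat.card_zpowers] at h1
    exact Nat.eq_of_mul_eq_mul_left Nat.card_pos h1
  have fH : Nat.card (U ⊓ Subgroup.zpowers γ : Subgroup Γ) = (P.under B).inertiaDegIn C := by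
    have h1 := card_stabilizer_eq_card_inertia_mul_finrank (G := H) (P.under B) P
    have h2 := (congrArg (fun S : Subgroup H => Nat.card S) hDH).symm.trans h1
    rw [← inertiaDegIn_eq_inertiaDeg (P.under B) P H, hIH, card_comap_eq, hrange] at h2
    exact Nat.eq_of_mul_eq_mul_left Nat.card_pos h2
  have gC : (p.primesOver C).ncard * orderOf γ = Nat.card Γ := by
    have h1 := ncard_primesOver_mul_card_inertia_mul_finrank (G := G) p P
    rw [← inertiaDegIn_eq_inertiaDeg p P G, ← fC, hI, card_eq_card_ker_mul_card_range ρ,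
      MonoidHom.range_eq_top.2 hρ, Subgroup.card_top, mul_right_comm, mul_comm] at h1
    exact Nat.eq_of_mul_eq_mul_left (Nat.card_pos (α := ρ.ker)) h1
  have gH : ((P.under B).primesOver C).ncard * Nat.card (U ⊓ Subgroup.zpowers γ : Subgroup Γ) =
      Nat.card U := by
    have h1 := ncard_primesOver_mul_card_inertia_mul_finrank (G := H) (P.under B) P
    rw [← inertiaDegIn_eq_inertiaDeg (P.under B) P H, ← fH, hIH,
      card_eq_card_ker_mul_card_range ρH, hrange, mul_right_comm, mul_comm] at h1
    exact Nat.eq_of_mul_eq_mul_left (Nat.card_pos (α := ρH.ker)) h1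
  have hord := orderOf_mk_mul_card U γ
  have hpos : 0 < Nat.card (U ⊓ Subgroup.zpowers γ : Subgroup Γ) := Nat.card_pos
  have hquot := Subgroup.card_eq_card_quotient_mul_card_subgroup U
  rw [← fH, ← fC] at fB
  refine ⟨Nat.eq_of_mul_eq_mul_right hpos (fB.trans hord.symm), ?_⟩
  refine Nat.eq_of_mul_eq_mul_right (Nat.card_pos (α := U)) ?_
  rw [← hquot, ← gC, ← gB, ← fB, ← gH]
  ring

end HilbertTheory

/-! ### The Carlitz action, its polynomials and their torsion -/

section CarlitzModule

variable {F : Type*} [Field F] [Fintype F]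

/-- The operator `x ↦ x ^ q + T x` on an `F[X]`-algebra. -/
def ctMap (R : Type*) [CommRing R] [Algebra F R] [Algebra F[X] R] : Module.End F R :=
  (FiniteField.frobeniusAlgHom F R).toLinearMap + LinearMap.mulLeft F (algebraMap F[X] R X)

/-- The Carlitz action of a polynomial on an `F[X]`-algebra. -/
def cact (R : Type*) [CommRing R] [Algebra F R] [Algebra F[X] R] (a : F[X]) : Module.End F R :=
  aeval (ctMap R) a

variable {R S : Type*} [CommRing R] [Algebra F R] [Algebra F[X] R]
  [CommRing S] [Algebra F S] [Algebra F[X] S]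

theorem ctMap_apply (x : R) : ctMap (F := F) R x = x ^ Fintype.card F + algebraMap F[X] R X * x :=
  rfl

theorem carlitzAct_eq_cact (a : F[X]) : carlitzAct F a = cact (Kac F) a := by
  unfold carlitzAct cact
  congr 1

theorem cact_mul (a b : F[X]) (x : R) : cact R (a * b) x = cact R a (cact R b x) := by
  simp [cact]

theorem cact_add (a b : F[X]) (x : R) : cact R (a + b) x = cact R a x + cact R b x := by
  simp [cact]

theorem cact_sub (a b : F[X]) (x : R) : cact R (a - b) x = cact R a x - cact R b x := by
  simp [cact]

theorem cact_C (c : F) (x : R) : cact R (C c) x = c • x := by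
  simp [cact, Module.algebraMap_end_apply]

@[simp]
theorem cact_one (x : R) : cact (F := F) R 1 x = x := by simp [cact]

@[simp]
theorem cact_zero (x : R) : cact (F := F) R 0 x = 0 := by simp [cact]

theorem cact_X (x : R) : cact (F := F) R X x = x ^ Fintype.card F + algebraMap F[X] R X * x := by
  simp [cact, ctMap_apply]

theorem cact_comm (a b : F[X]) (x : R) :
    cact R a (cact R b x) = cact R b (cact R a x) := by
  rw [← cact_mul, mul_comm, cact_mul]

/-- The Carlitz action commutes with homomorphisms of `F[X]`-algebras. -/
theorem map_cact [IsScalarTower F F[X] R] [IsScalarTower F F[X] S] {G : Type*} [FunLike G R S]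
    [AlgHomClass G F[X] R S] (f : G) (a : F[X]) (x : R) :
    f (cact R a x) = cact S a (f x) := by
  induction a using Polynomial.induction_on' generalizing x with
  | add p q hp hq => rw [cact_add, cact_add, map_add, hp, hq]
  | monomial n c =>
    rw [← C_mul_X_pow_eq_monomial, cact_mul, cact_mul, cact_C, cact_C]
    have h1 : ∀ y : R, f (c • y) = c • f y := fun y => by
      rw [← algebraMap_smul F[X] c y, ← algebraMap_smul F[X] c (f y), map_smul]
    rw [h1]
    congr 1
    induction n with
    | zero => simp
    | succ n ih => rw [pow_succ', cact_mul, cact_mul, cact_X, cact_X, ← ih, map_add, map_pow,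
        map_mul, AlgHomClass.commutes]

/-- The polynomial which defines the Carlitz action of `a`. -/
def cpoly (a : F[X]) : F[X][X] := cact F[X][X] a X

theorem aeval_cpoly [IsScalarTower F F[X] R] (a : F[X]) (x : R) :
    aeval x (cpoly a) = cact R a x := by
  unfold cpoly
  rw [map_cact (aeval x : F[X][X] →ₐ[F[X]] R), aeval_X]

theorem eval_map_cpoly [IsScalarTower F F[X] R] (a : F[X]) (x : R) :
    ((cpoly a).map (algebraMap F[X] R)).eval x = cact R a x := by
  rw [eval_map_algebraMap, aeval_cpoly]

theorem cpoly_C_mul (c : F) (a : F[X]) : cpoly (C c * a) = C (C c) * cpoly a := by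
  unfold cpoly
  rw [cact_mul, cact_C, Algebra.smul_def]; rfl

theorem cpoly_add (a b : F[X]) : cpoly (a + b) = cpoly a + cpoly b := cact_add _ _ _

theorem cpoly_X_pow_succ (n : ℕ) : cpoly (X ^ (n + 1) : F[X]) =
    cpoly (X ^ n) ^ Fintype.card F + C X * cpoly (X ^ n) := by
  unfold cpoly
  rw [pow_succ', cact_mul, cact_X]; rfl

theorem cpoly_X_pow_monic_natDegree (n : ℕ) :
    (cpoly (X ^ n : F[X])).Monic ∧ (cpoly (X ^ n : F[X])).natDegree = Fintype.card F ^ n := by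
  induction n with
  | zero => simp [cpoly, monic_X]
  | succ n ih =>
    obtain ⟨hm, hd⟩ := ih
    have hq : 1 < Fintype.card F := Fintype.one_lt_card
    have hm' := hm.pow (Fintype.card F)
    have hd' : (cpoly (X ^ n : F[X]) ^ Fintype.card F).natDegree = Fintype.card F ^ (n + 1) := by
      rw [hm.natDegree_pow, hd, pow_succ']
    have hlt : (C X * cpoly (X ^ n : F[X])).natDegree <
        (cpoly (X ^ n : F[X]) ^ Fintype.card F).natDegree := by
      rw [hd']
      refine (natDegree_C_mul_le _ _).trans_lt ?_
      rw [hd]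
      exact Nat.pow_lt_pow_right hq n.lt_succ_self
    rw [cpoly_X_pow_succ]
    have hlt' := degree_lt_degree hlt
    exact ⟨hm'.add_of_left hlt', by rw [natDegree_add_eq_left_of_natDegree_lt hlt, hd']⟩

/-- The term T^d contributes a monic polynomial of degree q^d, and each lower term T^i one of degree
at most q^i < q^d. -/
theorem cpoly_monic_natDegree {a : F[X]} (ha : a.Monic) :
    (cpoly a).Monic ∧ (cpoly a).natDegree = Fintype.card F ^ a.natDegree := by
  have hq : 1 < Fintype.card F := Fintype.one_lt_card
  obtain ⟨hm, hd⟩ := cpoly_X_pow_monic_natDegree (F := F) a.natDegree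
  have hsum : cpoly (∑ i ∈ Finset.range a.natDegree, C (a.coeff i) * X ^ i) =
      ∑ i ∈ Finset.range a.natDegree, cpoly (C (a.coeff i) * X ^ i) := by
    unfold cpoly cact
    rw [map_sum, LinearMap.sum_apply]
  have hlt : (cpoly (∑ i ∈ Finset.range a.natDegree, C (a.coeff i) * X ^ i)).degree <
      (cpoly (X ^ a.natDegree : F[X])).degree := by
    rw [hsum, degree_eq_natDegree hm.ne_zero, hd]
    refine (degree_sum_le _ _).trans_lt ((Finset.sup_lt_iff (WithBot.bot_lt_coe _)).2 ?_)
    intro i hi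
    rw [cpoly_C_mul]
    refine degree_le_natDegree.trans_lt ?_
    rw [Nat.cast_lt]
    refine (natDegree_C_mul_le _ _).trans_lt ?_
    rw [(cpoly_X_pow_monic_natDegree i).2]
    exact Nat.pow_lt_pow_right hq (Finset.mem_range.1 hi)
  have key : cpoly a = cpoly (X ^ a.natDegree : F[X]) +
      cpoly (∑ i ∈ Finset.range a.natDegree, C (a.coeff i) * X ^ i) := by
    rw [← cpoly_add, ← ha.as_sum]
  rw [key]
  exact ⟨hm.add_of_left hlt, by rw [natDegree_add_eq_left_of_degree_lt hlt, hd]⟩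

/-- The derivative of a q-th power vanishes, so of the operator of T only the linear part T·P
survives. For P = X this yields both the separability of the Carlitz polynomial and its linear
coefficient. -/
theorem derivative_cact (a : F[X]) (P : F[X][X]) :
    derivative (cact F[X][X] a P) = C a * derivative P := by
  have hq : (Fintype.card F : F[X][X]) = 0 := by
    have h : (Fintype.card F : F) = 0 := FiniteField.cast_card_eq_zero F
    rw [← map_natCast (algebraMap F F[X][X]) (Fintype.card F), h, map_zero]
  have hX : ∀ P : F[X][X],
      derivative (cact F[X][X] (X : F[X]) P) = C (X : F[X]) * derivative P := by
    intro P
    rw [cact_X, derivative_add, derivative_pow, map_natCast, hq, zero_mul, zero_mul, zero_add]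
    change derivative (C X * P) = _
    rw [derivative_C_mul]
  induction a using Polynomial.induction_on' generalizing P with
  | add p q hp hq => rw [cact_add, derivative_add, hp, hq, C_add, add_mul]
  | monomial n c =>
    rw [← C_mul_X_pow_eq_monomial, cact_mul, cact_C, Algebra.smul_def]
    change derivative (C (C c) * _) = _
    rw [derivative_C_mul, C_mul, mul_assoc]
    congr 1
    induction n with
    | zero => simp
    | succ n ih => rw [pow_succ', cact_mul, hX, ih, C_mul, mul_assoc]

theorem derivative_cpoly (a : F[X]) : derivative (cpoly a) = C a := by
  rw [cpoly, derivative_cact, derivative_X, mul_one]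

theorem coeff_zero_cpoly (a : F[X]) : (cpoly a).coeff 0 = 0 := by
  rw [coeff_zero_eq_aeval_zero, aeval_cpoly, map_zero]

theorem coeff_one_cpoly (a : F[X]) : (cpoly a).coeff 1 = a := by
  have := coeff_derivative (cpoly a) 0
  rw [derivative_cpoly, coeff_C_zero] at this
  simpa using this.symm

/-- `cpoly a = Y * g` with `g` of constant coefficient `a`. -/
theorem exists_cact_eq_mul [IsScalarTower F F[X] R] (a : F[X]) (x : R) :
    ∃ y : R, cact R a x = x * (algebraMap F[X] R a + x * y) := by
  have h := divX_mul_X_add (cpoly a)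
  have h2 := divX_mul_X_add (divX (cpoly a))
  rw [coeff_zero_cpoly, C_0, add_zero] at h
  rw [coeff_divX, zero_add, coeff_one_cpoly] at h2
  refine ⟨aeval x (divX (divX (cpoly a))), ?_⟩
  have h3 := congrArg (aeval x) h
  have h4 := congrArg (aeval x) h2
  simp only [map_mul, map_add, aeval_X, aeval_C, aeval_cpoly] at h3 h4
  rw [← h3, ← h4]
  ring

theorem card_quotient_span {n : F[X]} (hn : n ≠ 0) :
    Nat.card (F[X] ⧸ Ideal.span {n}) = Fintype.card F ^ n.natDegree := by
  have hb := (AdjoinRoot.powerBasis hn).finite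
  have : Module.Finite F (F[X] ⧸ Ideal.span {n}) := hb
  have : Finite (F[X] ⧸ Ideal.span {n}) := Module.finite_of_finite F
  have := Fintype.ofFinite (F[X] ⧸ Ideal.span {n})
  rw [Nat.card_eq_fintype_card, Module.card_eq_pow_finrank (K := F),
    finrank_quotient_span_eq_natDegree]

/-! ### Annihilators -/

theorem cact_eq_zero_of_dvd {a b : F[X]} {x : R} (h : a ∣ b) (hx : cact R a x = 0) :
    cact R b x = 0 := by
  obtain ⟨c, rfl⟩ := h
  rw [mul_comm, cact_mul, hx, map_zero]

theorem cact_eq_of_dvd_sub {n a b : F[X]} {x : R} (hx : cact R n x = 0) (h : n ∣ a - b) :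
    cact R a x = cact R b x := by
  rw [← sub_eq_zero, ← cact_sub]
  exact cact_eq_zero_of_dvd h hx

/-- `x` is a generator of a module isomorphic to `A/(n)` for the Carlitz action. -/
def HasAnnihilator (n : F[X]) (x : R) : Prop := ∀ a : F[X], cact R a x = 0 ↔ n ∣ a

/-- If a kills x, so does the gcd of a and Q^(n+1). This is a power of Q up to a unit, and an
exponent at most n is excluded. -/
theorem hasAnnihilator_of_irreducible_pow {Q : F[X]} (hQ : Irreducible Q) {n : ℕ} {x : R}
    (h1 : cact R (Q ^ (n + 1)) x = 0) (h2 : cact R (Q ^ n) x ≠ 0) :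
    HasAnnihilator (Q ^ (n + 1)) x := by
  classical
  intro a
  refine ⟨fun ha => ?_, fun h => cact_eq_zero_of_dvd h h1⟩
  have hg : cact R (EuclideanDomain.gcd (Q ^ (n + 1)) a) x = 0 := by
    rw [EuclideanDomain.gcd_eq_gcd_ab, mul_comm, mul_comm a, cact_add, cact_mul, cact_mul, h1, ha,
      map_zero, map_zero, add_zero]
  obtain ⟨i, hi, hass⟩ := (dvd_prime_pow hQ.prime _).1 (EuclideanDomain.gcd_dvd_left (Q ^ (n + 1)) a)
  rcases Nat.lt_or_ge i (n + 1) with hlt | hge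
  · refine absurd (cact_eq_zero_of_dvd ?_ hg) h2
    exact hass.dvd.trans (pow_dvd_pow Q (Nat.lt_succ_iff.1 hlt))
  · exact ((pow_dvd_pow Q hge).trans hass.symm.dvd).trans (EuclideanDomain.gcd_dvd_right _ _)

theorem HasAnnihilator.add {a b : F[X]} {x y : R} (h : IsCoprime a b) (hx : HasAnnihilator a x)
    (hy : HasAnnihilator b y) : HasAnnihilator (a * b) (x + y) := by
  have hx0 := (hx a).2 dvd_rfl
  have hy0 := (hy b).2 dvd_rfl
  intro c
  constructor
  · intro hc
    rw [map_add] at hc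
    refine h.mul_dvd ?_ ?_
    · have : cact R (b * c) x = 0 := by
        rw [cact_mul, eq_neg_of_add_eq_zero_left hc, map_neg, cact_comm, hy0, map_zero, neg_zero]
      exact h.dvd_of_dvd_mul_left ((hx _).1 this)
    · have : cact R (a * c) y = 0 := by
        rw [cact_mul, eq_neg_of_add_eq_zero_right hc, map_neg, cact_comm, hx0, map_zero, neg_zero]
      exact h.symm.dvd_of_dvd_mul_left ((hy _).1 this)
  · intro hc
    rw [map_add, cact_eq_zero_of_dvd ((dvd_mul_right a b).trans hc) hx0,
      cact_eq_zero_of_dvd ((dvd_mul_left b a).trans hc) hy0, add_zero]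

theorem HasAnnihilator.cact_eq_iff {n a b : F[X]} {x : R} (h : HasAnnihilator n x) :
    cact R a x = cact R b x ↔ n ∣ a - b := by
  rw [← sub_eq_zero, ← cact_sub, h]

/-- The orbit of an element with annihilator `n`, parametrised by `A/(n)`. -/
def orbitMap (n : F[X]) (x : R) (z : F[X] ⧸ Ideal.span {n}) : R :=
  cact R (Ideal.Quotient.mk_surjective z).choose x

theorem HasAnnihilator.orbitMap_mk {n : F[X]} {x : R} (h : HasAnnihilator n x) (a : F[X]) :
    orbitMap n x (Ideal.Quotient.mk _ a) = cact R a x := by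
  unfold orbitMap
  rw [h.cact_eq_iff, ← Ideal.mem_span_singleton, ← Ideal.Quotient.eq]
  exact (Ideal.Quotient.mk_surjective (Ideal.Quotient.mk (Ideal.span {n}) a)).choose_spec

theorem HasAnnihilator.orbitMap_injective {n : F[X]} {x : R} (h : HasAnnihilator n x) :
    Function.Injective (orbitMap n x) := by
  intro z w hzw
  obtain ⟨a, rfl⟩ := Ideal.Quotient.mk_surjective z
  obtain ⟨b, rfl⟩ := Ideal.Quotient.mk_surjective w
  rw [h.orbitMap_mk, h.orbitMap_mk, h.cact_eq_iff] at hzw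
  rwa [Ideal.Quotient.eq, Ideal.mem_span_singleton]

/-- The `a`-torsion for the Carlitz action on an `F[X]`-algebra. -/
def ctors (R : Type*) [CommRing R] [Algebra F R] [Algebra F[X] R] (a : F[X]) : Set R :=
  {x | cact R a x = 0}

theorem mem_ctors {a : F[X]} {x : R} : x ∈ ctors R a ↔ cact R a x = 0 := Iff.rfl

theorem HasAnnihilator.card_le {n : F[X]} {x : R} (h : HasAnnihilator n x)
    (hfin : (ctors R n).Finite) : Nat.card (F[X] ⧸ Ideal.span {n}) ≤ (ctors R n).ncard := by
  have := hfin.to_subtype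
  refine Nat.card_le_card_of_injective
    (fun z : F[X] ⧸ Ideal.span {n} => (⟨orbitMap n x z, ?_⟩ : ctors R n)) ?_
  · obtain ⟨a, rfl⟩ := Ideal.Quotient.mk_surjective z
    rw [h.orbitMap_mk, mem_ctors, cact_comm, (h n).2 dvd_rfl, map_zero]
  · intro z w hzw
    exact h.orbitMap_injective (congrArg Subtype.val hzw)

/-- An element with annihilator `n` generates the `n`-torsion, if that is not too large. -/
theorem HasAnnihilator.exists_cact_eq {n : F[X]} {x : R} (h : HasAnnihilator n x)
    (hfin : (ctors R n).Finite) (hcard : (ctors R n).ncard ≤ Nat.card (F[X] ⧸ Ideal.span {n}))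
    {y : R} (hy : y ∈ ctors R n) : ∃ a : F[X], y = cact R a x := by
  have hs : Set.range (orbitMap n x) ⊆ ctors R n := by
    rintro _ ⟨z, rfl⟩
    obtain ⟨a, rfl⟩ := Ideal.Quotient.mk_surjective z
    rw [h.orbitMap_mk, mem_ctors, cact_comm, (h n).2 dvd_rfl, map_zero]
  have heq := Set.eq_of_subset_of_ncard_le hs (by
    rw [← Set.image_univ, Set.ncard_image_of_injective _ h.orbitMap_injective, Set.ncard_univ]
    exact hcard) hfin
  rw [← heq] at hy
  obtain ⟨z, rfl⟩ := hy
  obtain ⟨a, rfl⟩ := Ideal.Quotient.mk_surjective z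
  exact ⟨a, h.orbitMap_mk a⟩

/-! ### Torsion in domains and algebraically closed fields -/

theorem ctors_finite [IsDomain R] [IsScalarTower F F[X] R] {a : F[X]} (ha : a.Monic) :
    (ctors R a).Finite := by
  have h0 : (cpoly a).map (algebraMap F[X] R) ≠ 0 :=
    ((cpoly_monic_natDegree ha).1.map _).ne_zero
  refine (((cpoly a).map (algebraMap F[X] R)).rootSet_finite R).subset fun x hx => ?_
  rw [mem_rootSet', Algebra.algebraMap_self, Polynomial.map_id]
  refine ⟨h0, ?_⟩
  rw [coe_aeval_eq_eval, eval_map_cpoly]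
  exact hx

section AlgClosed

variable {L : Type*} [Field L] [IsAlgClosed L] [Algebra F L] [Algebra F[X] L]
  [IsScalarTower F F[X] L]

/-- The Carlitz polynomial has the nonzero constant a as derivative, so its roots are simple and
their number is its degree. -/
theorem ncard_ctors_eq {a : F[X]} (ha : a.Monic) (h0 : algebraMap F[X] L a ≠ 0) :
    (ctors L a).ncard = Fintype.card F ^ a.natDegree := by
  classical
  obtain ⟨hm, hd⟩ := cpoly_monic_natDegree ha
  have hm' := hm.map (algebraMap F[X] L)
  have hsep : ((cpoly a).map (algebraMap F[X] L)).Separable := by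
    rw [Polynomial.separable_def, derivative_map, derivative_cpoly, map_C]
    exact (isCoprime_one_right).of_isCoprime_of_dvd_right
      (Polynomial.isUnit_C.2 h0.isUnit).dvd
  have hsub : ctors L a = (((cpoly a).map (algebraMap F[X] L)).roots.toFinset : Set L) := by
    ext x
    rw [Finset.mem_coe, Multiset.mem_toFinset, mem_roots hm'.ne_zero, IsRoot, eval_map_cpoly,
      mem_ctors]
  rw [hsub, Set.ncard_coe_finset, ← hd, ← hm.natDegree_map (algebraMap F[X] L),
    Multiset.toFinset_card_of_nodup (nodup_roots hsep),
    (IsAlgClosed.splits _).natDegree_eq_card_roots]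

/-- Over a field in which the irreducible `Q` vanishes, the Carlitz polynomial of `Q` is a power
of the variable. -/
theorem map_cpoly_eq_X_pow {Q : F[X]} (hQ : Irreducible Q) (hQm : Q.Monic)
    (h0 : algebraMap F[X] L Q = 0) :
    (cpoly Q).map (algebraMap F[X] L) = X ^ (Fintype.card F ^ Q.natDegree) := by
  classical
  obtain ⟨hm, hd⟩ := cpoly_monic_natDegree hQm
  have hm' := hm.map (algebraMap F[X] L)
  have hd' := (hm.natDegree_map (algebraMap F[X] L)).trans hd
  set p := (cpoly Q).map (algebraMap F[X] L) with hp
  have hsplit : p.Splits := IsAlgClosed.splits p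
  have hcardroots := hsplit.natDegree_eq_card_roots
  have hpos : 0 < Fintype.card F ^ Q.natDegree := pow_pos Fintype.card_pos _
  have hder : derivative p = 0 := by
    rw [hp, derivative_map, derivative_cpoly, map_C, h0, C_0]
  -- A nonzero root would have annihilator Q, and its orbit would supply as many distinct roots as
  -- the degree. Then p would be separable, but its derivative is the constant Q, which vanishes in
  -- L.
  have hroot0 : ∀ x ∈ p.roots, x = 0 := by
    intro x hx
    by_contra hx0
    have hxQ : cact L Q x = 0 := by
      rw [mem_roots hm'.ne_zero, IsRoot, hp, eval_map_cpoly] at hx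
      exact hx
    have hann : HasAnnihilator Q x := by
      have := hasAnnihilator_of_irreducible_pow (R := L) hQ (n := 0) (x := x) (by simpa using hxQ)
        (by simpa using hx0)
      simpa using this
    have hle := hann.card_le (ctors_finite hQm)
    have hsub : ctors L Q = (p.roots.toFinset : Set L) := by
      ext x
      rw [Finset.mem_coe, Multiset.mem_toFinset, mem_roots hm'.ne_zero, IsRoot, hp, eval_map_cpoly,
        mem_ctors]
    rw [card_quotient_span hQm.ne_zero, hsub, Set.ncard_coe_finset, ← hd', hcardroots] at hle
    have hnodup := Multiset.toFinset_card_eq_card_iff_nodup.1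
      (le_antisymm (Multiset.toFinset_card_le _) hle)
    have hsep := (nodup_roots_iff_of_splits hm'.ne_zero hsplit).1 hnodup
    rw [Polynomial.separable_def, hder, isCoprime_zero_right] at hsep
    have := Polynomial.natDegree_eq_zero_of_isUnit hsep
    omega
  have hrep := Multiset.eq_replicate_card.2 hroot0
  rw [hsplit.eq_prod_roots_of_monic hm', hrep, Multiset.map_replicate, Multiset.prod_replicate,
    C_0, sub_zero, ← hcardroots, hd']

end AlgClosed

/-- The Carlitz action of a monic irreducible `Q` of degree `d` reduces modulo `Q` to the
`q ^ d`-th power map. -/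
theorem dvd_cact_sub_pow [IsScalarTower F F[X] R] {Q : F[X]} (hQ : Irreducible Q) (hQm : Q.Monic)
    (x : R) :
    algebraMap F[X] R Q ∣ cact R Q x - x ^ (Fintype.card F ^ Q.natDegree) := by
  have hmax : (Ideal.span {Q}).IsMaximal := PrincipalIdealRing.isMaximal_of_irreducible hQ
  let κ := F[X] ⧸ Ideal.span {Q}
  let _ : Field κ := Ideal.Quotient.field _
  have h := map_cpoly_eq_X_pow (L := AlgebraicClosure κ) hQ hQm (by
    rw [IsScalarTower.algebraMap_apply F[X] κ (AlgebraicClosure κ)]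
    have : algebraMap F[X] κ Q = 0 := Ideal.Quotient.eq_zero_iff_mem.2
      (Ideal.mem_span_singleton_self Q)
    rw [this, map_zero])
  have h1 : C Q ∣ cpoly Q - X ^ (Fintype.card F ^ Q.natDegree) := by
    rw [C_dvd_iff_dvd_coeff]
    intro i
    have h2 := congrArg (fun P => coeff P i) h
    simp only [coeff_map] at h2
    rw [← Ideal.mem_span_singleton, ← Ideal.Quotient.eq_zero_iff_mem]
    refine (algebraMap κ (AlgebraicClosure κ)).injective ?_
    rw [map_zero, coeff_sub, map_sub, map_sub]
    change algebraMap κ _ (algebraMap F[X] κ _) - algebraMap κ _ (algebraMap F[X] κ _) = 0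
    rw [← IsScalarTower.algebraMap_apply, ← IsScalarTower.algebraMap_apply, h2, coeff_X_pow,
      coeff_X_pow]
    split_ifs <;> simp
  obtain ⟨P, hP⟩ := h1
  refine ⟨aeval x P, ?_⟩
  have h3 := congrArg (aeval x) hP
  simpa only [map_sub, map_mul, map_pow, aeval_X, aeval_C, aeval_cpoly] using h3

/-- The product of the nonzero `a`-torsion points, if the `a`-torsion has full size. -/
theorem prod_neg_ctors [IsDomain R] [IsScalarTower F F[X] R] {a : F[X]} (ha : a.Monic)
    (hcard : (ctors R a).ncard = Fintype.card F ^ a.natDegree) :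
    ∏ᶠ x ∈ ctors R a \ {0}, -x = algebraMap F[X] R a := by
  classical
  obtain ⟨hm, hd⟩ := cpoly_monic_natDegree ha
  have hm' := hm.map (algebraMap F[X] R)
  have hd' := (hm.natDegree_map (algebraMap F[X] R)).trans hd
  set p := (cpoly a).map (algebraMap F[X] R) with hp
  have hsub : ctors R a = (p.roots.toFinset : Set R) := by
    ext x
    rw [Finset.mem_coe, Multiset.mem_toFinset, mem_roots hm'.ne_zero, IsRoot, hp, eval_map_cpoly,
      mem_ctors]
  rw [hsub, Set.ncard_coe_finset, ← hd'] at hcard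
  have hle := card_roots' p
  have hle2 := Multiset.toFinset_card_le p.roots
  have hnodup := Multiset.toFinset_card_eq_card_iff_nodup.1 (le_antisymm hle2 (by omega))
  have hprod := prod_multiset_X_sub_C_of_monic_of_roots_card_eq hm' (le_antisymm hle (by omega))
  have h0 : (0 : R) ∈ p.roots.toFinset := by
    rw [Multiset.mem_toFinset, mem_roots hm'.ne_zero, IsRoot, hp, eval_map_cpoly, map_zero]
  have hprod2 : ∏ x ∈ p.roots.toFinset, (X - C x) = p := by
    conv_rhs => rw [← hprod]
    rw [Finset.prod, Multiset.toFinset_val, hnodup.dedup]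
  rw [hsub, ← Finset.coe_singleton, ← Finset.coe_sdiff, finprod_mem_coe_finset,
    Finset.sdiff_singleton_eq_erase]
  rw [← Finset.mul_prod_erase _ _ h0, C_0, sub_zero] at hprod2
  -- In X ∏ (X - x), over the nonzero torsion points x, the linear coefficient is ∏ (-x); in the
  -- Carlitz polynomial it is a.
  have h1 := congrArg (fun P => coeff P 1) hprod2
  have h2 : coeff p 1 = algebraMap F[X] R a := by rw [hp, coeff_map, coeff_one_cpoly]
  rw [← h2, ← h1, coeff_X_mul, coeff_zero_eq_eval_zero, eval_prod]
  simp

end CarlitzModule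

/-! ### Galois action on torsion points, and torsion modulo a prime -/

section Ramification

set_option linter.unusedSectionVars false

open scoped Pointwise

/-- On the finite field B/P every element of the decomposition group acts as a power of the
|A/p|-power map, hence as a power of φ; the quotient of the two acts trivially on B/P. -/
theorem exists_mul_frobenius_mem_inertia {A B G : Type*} [CommRing A] [CommRing B] [Algebra A B]
    [Group G] [MulSemiringAction G B] [SMulCommClass G A B]
    (p : Ideal A) [p.IsMaximal] [Finite (A ⧸ p)] (P : Ideal B) [P.IsMaximal] [P.LiesOver p]
    [Finite (B ⧸ P)] (φ : G) (hφ : IsArithFrobAt A φ P) {σ : G}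
    (hσ : σ ∈ MulAction.stabilizer G P) : ∃ i : ℕ, σ * (φ ^ i)⁻¹ ∈ P.inertia G := by
  let _ : Field (A ⧸ p) := Ideal.Quotient.field p
  let _ : Field (B ⧸ P) := Ideal.Quotient.field P
  obtain ⟨c, hc⟩ := CharP.exists (A ⧸ p)
  have : Fact c.Prime := ⟨CharP.char_is_prime (A ⧸ p) c⟩
  obtain ⟨i, hi⟩ := FiniteField.exists_forall_apply_eq_pow (A ⧸ p) c (B ⧸ P)
    (Ideal.Quotient.stabilizerHom P p G ⟨σ, hσ⟩)
  have hcard : Nat.card (A ⧸ P.under A) = Nat.card (A ⧸ p) := by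
    rw [← Ideal.over_def P p]
  have hpow : ∀ (j : ℕ) (x : B), Ideal.Quotient.mk P (φ ^ j • x) =
      Ideal.Quotient.mk P x ^ (Nat.card (A ⧸ p) ^ j) := by
    intro j
    induction j with
    | zero => intro x; simp
    | succ j ih =>
      intro x
      rw [pow_succ, mul_smul, ih, pow_succ', pow_mul]
      congr 1
      have := hφ.mk_apply x
      rw [hcard] at this
      exact this
  refine ⟨i, fun x => ?_⟩
  change _ ∈ P
  rw [← Ideal.Quotient.eq]
  have h1 := hi (Ideal.Quotient.mk P ((φ ^ i)⁻¹ • x))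
  rw [← hpow, smul_inv_smul] at h1
  rw [mul_smul]
  exact h1

variable {F : Type*} [Field F] [Fintype F] {R : Type*} [CommRing R] [Algebra F R]
  [Algebra F[X] R] [IsScalarTower F F[X] R]

/-- All torsion points for divisors of `m` are available in `R`. -/
def FullTorsion (R : Type*) [CommRing R] [Algebra F R] [Algebra F[X] R] (m : F[X]) : Prop :=
  ∀ a, a ∣ m → (ctors R a).ncard = Fintype.card F ^ a.natDegree

theorem FullTorsion.of_dvd {m n : F[X]} (h : FullTorsion R m) (hn : n ∣ m) : FullTorsion R n :=
  fun a ha => h a (ha.trans hn)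

theorem FullTorsion.finite {m : F[X]} (h : FullTorsion R m) : (ctors R m).Finite := by
  by_contra hinf
  have := h m dvd_rfl
  -- An infinite set has `ncard` 0, whereas fullness demands a power of q.
  rw [Set.Infinite.ncard hinf] at this
  exact absurd this.symm (pow_pos Fintype.card_pos _).ne'

theorem ctors_mono {a b : F[X]} (h : a ∣ b) : ctors R a ⊆ ctors R b :=
  fun _ hx => cact_eq_zero_of_dvd h hx

/-- For a prime power the torsion is strictly larger than that of the preceding power, and any new
point works. Points for coprime factors are added. -/
theorem exists_hasAnnihilator {n : F[X]} (hn : n ≠ 0) (hfull : FullTorsion R n) :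
    ∃ x : R, HasAnnihilator n x := by
  induction n using UniqueFactorizationMonoid.induction_on_coprime with
  | h0 => exact absurd rfl hn
  | @h1 n hu => exact ⟨0, fun a => by simp [hu.dvd]⟩
  | @hpr p i hp =>
    rcases i with _ | i
    · exact ⟨0, fun a => by simp⟩
    · have hlt : (ctors R (p ^ i)).ncard < (ctors R (p ^ (i + 1))).ncard := by
        rw [hfull _ dvd_rfl, hfull _ (pow_dvd_pow p i.le_succ)]
        refine Nat.pow_lt_pow_right Fintype.one_lt_card ?_
        rw [natDegree_pow, natDegree_pow]
        have := hp.irreducible.natDegree_pos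
        nlinarith
      obtain ⟨x, hx, hx'⟩ := Set.exists_mem_notMem_of_ncard_lt_ncard hlt
        ((hfull.of_dvd (pow_dvd_pow p i.le_succ)).finite)
      exact ⟨x, hasAnnihilator_of_irreducible_pow hp.irreducible hx hx'⟩
  | @hcp a b hab iha ihb =>
    obtain ⟨x, hx⟩ := iha (left_ne_zero_of_mul hn) (hfull.of_dvd (dvd_mul_right a b))
    obtain ⟨y, hy⟩ := ihb (right_ne_zero_of_mul hn) (hfull.of_dvd (dvd_mul_left b a))
    exact ⟨x + y, hx.add hab.isCoprime hy⟩

theorem HasAnnihilator.exists_cact_eq_of_fullTorsion {n : F[X]} (hn : n ≠ 0)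
    (hfull : FullTorsion R n) {x y : R} (h : HasAnnihilator n x) (hy : y ∈ ctors R n) :
    ∃ a : F[X], y = cact R a x :=
  h.exists_cact_eq hfull.finite (by rw [hfull n dvd_rfl, card_quotient_span hn]) hy

section Action

variable {G : Type*} [Group G] [MulSemiringAction G R] [SMulCommClass G F[X] R]

theorem smul_cact (σ : G) (a : F[X]) (x : R) : σ • cact R a x = cact R a (σ • x) :=
  map_cact (MulSemiringAction.toAlgHom F[X] R σ) a x

theorem smul_mem_ctors {σ : G} {a : F[X]} {x : R} (hx : x ∈ ctors R a) : σ • x ∈ ctors R a := by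
  rw [mem_ctors, ← smul_cact, mem_ctors.1 hx, smul_zero]

/-- `σ` acts on the `n`-torsion as the polynomial `a`. -/
def ActsAs (σ : G) (n a : F[X]) : Prop := ∀ x ∈ ctors R n, σ • x = cact R a x

theorem ActsAs.mul {σ τ : G} {n a b : F[X]} (h : ActsAs (R := R) σ n a)
    (h' : ActsAs (R := R) τ n b) : ActsAs (R := R) (σ * τ) n (a * b) := by
  intro x hx
  rw [mul_smul, h' x hx, smul_cact, h x hx, cact_mul, cact_comm]

theorem ActsAs.congr {σ : G} {n a b : F[X]} (h : ActsAs (R := R) σ n a) (hab : n ∣ a - b) :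
    ActsAs (R := R) σ n b := fun x hx => by
  rw [h x hx, cact_eq_of_dvd_sub hx hab]

theorem ActsAs.of_dvd {σ : G} {n d a : F[X]} (h : ActsAs (R := R) σ n a) (hd : d ∣ n) :
    ActsAs (R := R) σ d a := fun x hx => h x (ctors_mono hd hx)

/-- Bézout splits each nd-torsion point into an n-torsion and a d-torsion point. -/
theorem ActsAs.of_isCoprime {σ : G} {n d a : F[X]} (h : ActsAs (R := R) σ n a)
    (h' : ActsAs (R := R) σ d a) (hc : IsCoprime n d) : ActsAs (R := R) σ (n * d) a := by
  intro x hx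
  obtain ⟨u, v, huv⟩ := hc
  have hsum : x = cact R (v * d) x + cact R (u * n) x := by
    rw [← cact_add, add_comm, huv, cact_one]
  have h1 : cact R (v * d) x ∈ ctors R n := by
    rw [mem_ctors, ← cact_mul]
    exact cact_eq_zero_of_dvd ⟨v, by ring⟩ hx
  have h2 : cact R (u * n) x ∈ ctors R d := by
    rw [mem_ctors, ← cact_mul]
    exact cact_eq_zero_of_dvd ⟨u, by ring⟩ hx
  rw [hsum, smul_add, h _ h1, h' _ h2, map_add]

theorem actsAs_of_generator {n a : F[X]} (hn : n ≠ 0) (hfull : FullTorsion R n) {x : R}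
    (hx : HasAnnihilator n x) {σ : G} (h : σ • x = cact R a x) : ActsAs (R := R) σ n a := by
  intro y hy
  obtain ⟨b, rfl⟩ := hx.exists_cact_eq_of_fullTorsion hn hfull hy
  rw [smul_cact, h, cact_comm]

variable (G) in
/-- The Galois representation on the `n`-torsion. -/
theorem exists_galoisRep {n : F[X]} (hn : n ≠ 0) (hfull : FullTorsion R n) :
    ∃ ρ : G →* (F[X] ⧸ Ideal.span {n})ˣ, ∀ (σ : G) (a : F[X]),
      (ρ σ : F[X] ⧸ Ideal.span {n}) = Ideal.Quotient.mk _ a ↔ ActsAs (R := R) σ n a := by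
  obtain ⟨x, hx⟩ := exists_hasAnnihilator hn hfull
  have hx0 : x ∈ ctors R n := (hx n).2 dvd_rfl
  have hex : ∀ σ : G, ∃ a : F[X], σ • x = cact R a x := fun σ =>
    hx.exists_cact_eq_of_fullTorsion hn hfull (smul_mem_ctors hx0)
  choose f hf using hex
  have key : ∀ (σ : G) (a : F[X]), Ideal.Quotient.mk (Ideal.span {n}) (f σ) =
      Ideal.Quotient.mk _ a ↔ ActsAs (R := R) σ n a := by
    intro σ a
    rw [Ideal.Quotient.eq, Ideal.mem_span_singleton]
    constructor
    · exact fun h => (actsAs_of_generator hn hfull hx (hf σ)).congr h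
    · intro h
      rw [← hx.cact_eq_iff, ← hf, h x hx0]
  let ρ₀ : G →* F[X] ⧸ Ideal.span {n} :=
    { toFun := fun σ => Ideal.Quotient.mk _ (f σ)
      map_one' := by
        rw [← map_one (Ideal.Quotient.mk (Ideal.span {n})), key]
        intro y _
        rw [one_smul, cact_one]
      map_mul' := fun σ τ => by
        rw [← map_mul, key]
        exact ((key σ _).1 rfl).mul ((key τ _).1 rfl) }
  exact ⟨ρ₀.toHomUnits, key⟩

end Action

section Primes

variable {Q : F[X]} (P : Ideal R) [P.IsPrime] [P.LiesOver (Ideal.span {Q})]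

theorem algebraMap_mem_iff_dvd (a : F[X]) : algebraMap F[X] R a ∈ P ↔ Q ∣ a := by
  rw [← Ideal.mem_span_singleton, Ideal.mem_of_liesOver P (Ideal.span {Q})]

/-- Reduction modulo a prime not dividing `n` is injective on the `n`-torsion. -/
theorem eq_zero_of_mem_ctors_of_mem [IsDomain R] {n : F[X]} (hn : ¬ Q ∣ n) {x : R} (hx : x ∈ ctors R n)
    (hxP : x ∈ P) : x = 0 := by
  obtain ⟨y, hy⟩ := exists_cact_eq_mul n x
  rw [mem_ctors.1 hx] at hy
  -- Here x(n + xy) = 0. If the second factor vanishes, then n = -xy lies in P, against Q ∤ n.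
  rcases mul_eq_zero.1 hy.symm with h | h
  · exact h
  · refine absurd ((algebraMap_mem_iff_dvd P n).1 ?_) hn
    rw [eq_neg_of_add_eq_zero_left h]
    exact P.neg_mem (P.mul_mem_right _ hxP)

theorem cact_sub_pow_mem (hQ : Irreducible Q) (hQm : Q.Monic) (x : R) :
    cact R Q x - x ^ (Fintype.card F ^ Q.natDegree) ∈ P :=
  P.mem_of_dvd (dvd_cact_sub_pow hQ hQm x) ((algebraMap_mem_iff_dvd P Q).2 dvd_rfl)

/-- Modulo P the operator of Q is a power map, so P contains x as soon as it contains the image of x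
under Q. -/
theorem mem_of_mem_ctors_pow (hQ : Irreducible Q) (hQm : Q.Monic) {k : ℕ} {x : R}
    (hx : x ∈ ctors R (Q ^ k)) : x ∈ P := by
  induction k generalizing x with
  | zero =>
    rw [mem_ctors, pow_zero, cact_one] at hx
    rw [hx]; exact P.zero_mem
  | succ k ih =>
    rw [mem_ctors, pow_succ, cact_mul] at hx
    have h1 := ih hx
    have h2 := cact_sub_pow_mem P hQ hQm x
    exact ‹P.IsPrime›.mem_of_pow_mem _ (by simpa using P.sub_mem h1 h2)

/-- Dividing the product formulas for the nonzero torsion of Q^(k+1) and of Q^k writes Q as the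
product of the negatives of the points of exact order Q^(k+1), each of which lies in P. This is the
lower bound for ramification. -/
theorem algebraMap_mem_pow [IsDomain R] (hinj : Function.Injective (algebraMap F[X] R))
    (hQ : Irreducible Q) (hQm : Q.Monic) (k : ℕ) (hfull : FullTorsion R (Q ^ (k + 1))) :
    algebraMap F[X] R Q ∈ P ^ (ctors R (Q ^ (k + 1)) \ ctors R (Q ^ k)).ncard := by
  classical
  have hk : Q ^ k ∣ Q ^ (k + 1) := pow_dvd_pow Q k.le_succ
  have h1 := prod_neg_ctors (R := R) (hQm.pow (k + 1)) (hfull _ dvd_rfl)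
  have h2 := prod_neg_ctors (R := R) (hQm.pow k) (hfull _ hk)
  have hfin := hfull.finite
  have hfin' := hfin.subset (Set.sdiff_subset (t := ctors R (Q ^ k)))
  have hunion : ctors R (Q ^ (k + 1)) \ {0} =
      (ctors R (Q ^ (k + 1)) \ ctors R (Q ^ k)) ∪ (ctors R (Q ^ k) \ {0}) := by
    ext x
    have : x ∈ ctors R (Q ^ k) → x ∈ ctors R (Q ^ (k + 1)) := fun hx => ctors_mono hk hx
    have h0 : (0 : R) ∈ ctors R (Q ^ k) := by rw [mem_ctors, map_zero]
    simp only [Set.mem_sdiff, Set.mem_union, Set.mem_singleton_iff]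
    constructor
    · rintro ⟨hx, hx0⟩
      by_cases hxk : x ∈ ctors R (Q ^ k)
      · exact Or.inr ⟨hxk, hx0⟩
      · exact Or.inl ⟨hx, hxk⟩
    · rintro (⟨hx, hxk⟩ | ⟨hxk, hx0⟩)
      · exact ⟨hx, fun h => hxk (h ▸ h0)⟩
      · exact ⟨this hxk, hx0⟩
  rw [hunion, finprod_mem_union _ hfin' ((hfull.of_dvd hk).finite.subset Set.sdiff_subset), h2,
    show algebraMap F[X] R (Q ^ (k + 1)) = algebraMap F[X] R Q * algebraMap F[X] R (Q ^ k) by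
      rw [← map_mul, pow_succ']] at h1
  · have hne : algebraMap F[X] R (Q ^ k) ≠ 0 := by
      rw [Ne, map_eq_zero_iff _ hinj]
      exact pow_ne_zero _ hQ.ne_zero
    rw [← mul_right_cancel₀ hne h1, finprod_mem_eq_finite_toFinset_prod _ hfin',
      Set.ncard_eq_toFinset_card _ hfin', ← Finset.prod_const]
    refine Ideal.prod_mem_prod fun x hx => P.neg_mem ?_
    rw [Set.Finite.mem_toFinset] at hx
    exact mem_of_mem_ctors_pow P hQ hQm hx.1
  · rw [Set.disjoint_left]
    exact fun x hx hx' => hx.2 hx'.1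

end Primes

end Ramification

/-! ### Inertia and decomposition groups on the torsion -/

section Decomposition

open scoped Pointwise

set_option linter.unusedSectionVars false

/-- The order of the inertia group is the ramification index, that is, the multiplicity of P in pB.
-/
theorem le_card_inertia {A B G : Type*} [CommRing A] [IsDomain A] [CommRing B] [IsDedekindDomain B]
    [Algebra A B] [FaithfulSMul A B] [Module.Finite A B] [Module.Flat A B] [Group G] [Finite G]
    [MulSemiringAction G B] [IsGaloisGroup G A B] (p : Ideal A) [p.IsPrime] (hp : p ≠ ⊥)
    [PerfectField p.ResidueField] (P : Ideal B) [P.IsPrime] [P.LiesOver p] {N : ℕ}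
    (h : p.map (algebraMap A B) ≤ P ^ N) : N ≤ Nat.card (P.inertia G) := by
  have hne : p.map (algebraMap A B) ≠ ⊥ := by
    rwa [Ne, Ideal.map_eq_bot_iff_of_injective (FaithfulSMul.algebraMap_injective A B)]
  rw [Ideal.card_inertia_eq_ramificationIdxIn (G := G) p P,
    Ideal.ramificationIdxIn_eq_ramificationIdx p P G,
    ← Ideal.ramificationIdx'_eq_ramificationIdx' p P hne]
  by_contra! hlt
  have h0 : P ≠ ⊥ := by
    rintro rfl
    refine hne (le_bot_iff.1 (Ideal.map_le_iff_le_comap.2 ?_))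
    exact (Ideal.over_def (⊥ : Ideal B) p).le
  rw [Ideal.IsDedekindDomain.ramificationIdx'_eq_multiplicity hne ‹_›] at hlt
  have hfin : FiniteMultiplicity P (p.map (algebraMap A B)) :=
    FiniteMultiplicity.of_not_isUnit
      (fun hu => ‹P.IsPrime›.ne_top (Ideal.isUnit_iff.1 hu)) hne
  exact absurd (hfin.le_multiplicity_of_pow_dvd (Ideal.dvd_iff_le.2 h)) (not_le.2 hlt)

variable {F : Type*} [Field F] [Fintype F]

theorem isMaximal_span {Q : F[X]} (hQ : Irreducible Q) : (Ideal.span {Q}).IsMaximal :=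
  PrincipalIdealRing.isMaximal_of_irreducible hQ

theorem finite_quotient_span {Q : F[X]} (hQ : Q ≠ 0) : Finite (F[X] ⧸ Ideal.span {Q}) :=
  Nat.finite_of_card_ne_zero (by
    rw [card_quotient_span hQ]; exact (pow_pos Fintype.card_pos _).ne')

theorem finite_residueField {A : Type*} [CommRing A] (p : Ideal A) [p.IsMaximal] [Finite (A ⧸ p)] :
    Finite p.ResidueField :=
  Finite.of_surjective _ (Ideal.bijective_algebraMap_quotient_residueField p).2

theorem finite_quotient_of_liesOver {B : Type*} [CommRing B] [Algebra F[X] B]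
    [Module.Finite F[X] B] {Q : F[X]} (hQ : Irreducible Q) (P : Ideal B)
    [P.LiesOver (Ideal.span {Q})] : Finite (B ⧸ P) := by
  have := finite_quotient_span hQ.ne_zero
  exact Module.finite_of_finite (F[X] ⧸ Ideal.span {Q})

theorem isMaximal_of_liesOver {B : Type*} [CommRing B] [Algebra F[X] B]
    [Module.Finite F[X] B] {Q : F[X]} (hQ : Irreducible Q) (P : Ideal B) [P.IsPrime]
    [P.LiesOver (Ideal.span {Q})] : P.IsMaximal := by
  have := finite_quotient_of_liesOver hQ P
  exact Ideal.Quotient.maximal_of_isField _ (Finite.isField_of_domain (B ⧸ P))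

variable {R : Type*} [CommRing R] [IsDedekindDomain R] [Algebra F R]
  [Algebra F[X] R] [IsScalarTower F F[X] R] [FaithfulSMul F[X] R] [Module.Finite F[X] R]

variable {G : Type*} [Group G] [Finite G] [MulSemiringAction G R] [IsGaloisGroup G F[X] R]

/-- For n-torsion x the difference σx - x is n-torsion in P, hence zero. -/
theorem actsAs_one_of_mem_inertia {Q n : F[X]} (hQn : ¬ Q ∣ n) (P : Ideal R) [P.IsPrime]
    [P.LiesOver (Ideal.span {Q})] {σ : G} (hσ : σ ∈ P.inertia G) : ActsAs (R := R) σ n 1 := by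
  intro x hx
  rw [cact_one, ← sub_eq_zero]
  refine eq_zero_of_mem_ctors_of_mem P hQn ?_ (hσ x)
  rw [mem_ctors, map_sub, mem_ctors.1 hx, mem_ctors.1 (smul_mem_ctors hx), sub_zero]

/-- Modulo P both σ and the Carlitz action of Q are the q^(deg Q)-th power map, and reduction is
injective on the n-torsion. -/
theorem actsAs_frobenius {Q n : F[X]} (hQ : Irreducible Q) (hQm : Q.Monic) (hQn : ¬ Q ∣ n)
    (P : Ideal R) [P.IsPrime] [P.LiesOver (Ideal.span {Q})] {σ : G}
    (hσ : IsArithFrobAt F[X] σ P) : ActsAs (R := R) σ n Q := by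
  intro x hx
  rw [← sub_eq_zero]
  refine eq_zero_of_mem_ctors_of_mem P hQn ?_ ?_
  · rw [mem_ctors, map_sub, mem_ctors.1 (smul_mem_ctors hx), cact_comm, mem_ctors.1 hx, map_zero,
      sub_zero]
  · have h1 := hσ x
    have h2 := cact_sub_pow_mem P hQ hQm x
    rw [← Ideal.over_def P (Ideal.span {Q}), card_quotient_span hQ.ne_zero] at h1
    have h3 := P.sub_mem h1 h2
    rwa [sub_sub_sub_cancel_right] at h3

/-- Let T be the points of exact order Q^(k+1) and x a generator among them. Inertia is trivial on
the m'-torsion, so by faithfulness σ ↦ σx embeds it into T. As T has at most as many elements as the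
inertia group, the embedding is a bijection. Hence inertia realises every class prime to Q on the
Q-part, and any σ trivial on the m'-torsion agrees on x with an inertia element and so equals it. -/
theorem inertia_structure {m Q m' : F[X]} {k : ℕ} (hm : m = Q ^ (k + 1) * m')
    (hfull : FullTorsion R m) (hfaith : ∀ σ : G, ActsAs (R := R) σ m 1 → σ = 1)
    (hQ : Irreducible Q) (hQm : Q.Monic) (hQm' : ¬ Q ∣ m') (P : Ideal R) [P.IsPrime]
    [P.LiesOver (Ideal.span {Q})] :
    (∀ a, IsCoprime a m → m' ∣ a - 1 → ∃ σ : G, ActsAs (R := R) σ m a) ∧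
    (∀ σ : G, σ ∈ P.inertia G ↔ ActsAs (R := R) σ m' 1) := by
  have hmax := isMaximal_span hQ
  have := finite_quotient_span hQ.ne_zero
  have := finite_residueField (Ideal.span {Q})
  have hcop : IsCoprime (Q ^ (k + 1)) m' := (hQ.coprime_iff_not_dvd.2 hQm').pow_left
  have hQk : Q ^ (k + 1) ∣ m := ⟨m', hm⟩
  have hfullQ := hfull.of_dvd hQk
  have hQ0 : Q ^ (k + 1) ≠ 0 := pow_ne_zero _ hQ.ne_zero
  obtain ⟨x, hx⟩ := exists_hasAnnihilator hQ0 hfullQ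
  have hx0 : x ∈ ctors R (Q ^ (k + 1)) := (hx _).2 dvd_rfl
  set T := ctors R (Q ^ (k + 1)) \ ctors R (Q ^ k) with hT
  have hTfin : T.Finite := hfullQ.finite.subset Set.sdiff_subset
  have hcard : T.ncard ≤ Nat.card (P.inertia G) := by
    refine le_card_inertia (Ideal.span {Q}) ?_ P ?_
    · rw [Ne, Ideal.span_singleton_eq_bot]; exact hQ.ne_zero
    · rw [Ideal.map_span, Set.image_singleton, Ideal.span_singleton_le_iff_mem]
      exact algebraMap_mem_pow P (FaithfulSMul.algebraMap_injective F[X] R) hQ hQm k hfullQ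
  have hxT : ∀ a, IsCoprime a Q → cact R a x ∈ T := by
    intro a ha
    refine ⟨?_, fun h => ?_⟩
    · rw [mem_ctors, cact_comm, mem_ctors.1 hx0, map_zero]
    · rw [mem_ctors, ← cact_mul, hx, pow_succ] at h
      have h1 := (mul_dvd_mul_iff_left (pow_ne_zero k hQ.ne_zero)).1 h
      exact hQ.not_isUnit (ha.isUnit_of_dvd' h1 dvd_rfl)
  have hsT : ∀ σ : G, σ • x ∈ T := by
    intro σ
    refine ⟨smul_mem_ctors hx0, fun h => ?_⟩
    have h1 := smul_mem_ctors (σ := σ⁻¹) h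
    rw [inv_smul_smul] at h1
    have h2 := hxT 1 isCoprime_one_left
    rw [cact_one] at h2
    exact h2.2 h1
  have hext : ∀ σ τ : G, ActsAs (R := R) (σ⁻¹ * τ) m' 1 → σ • x = τ • x → σ = τ := by
    intro σ τ h1 h2
    have h3 : (σ⁻¹ * τ) • x = cact R (1 : F[X]) x := by
      rw [mul_smul, ← h2, inv_smul_smul, cact_one]
    have h4 := (actsAs_of_generator hQ0 hfullQ hx h3).of_isCoprime h1 hcop
    rw [← hm] at h4
    exact inv_mul_eq_one.1 (hfaith _ h4)
  have hI1 : ∀ σ ∈ P.inertia G, ActsAs (R := R) σ m' 1 := fun σ hσ =>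
    actsAs_one_of_mem_inertia hQm' P hσ
  have hrange : Set.range (fun σ : P.inertia G => (σ : G) • x) = T := by
    refine Set.eq_of_subset_of_ncard_le ?_ ?_ hTfin
    · rintro _ ⟨σ, rfl⟩
      exact hsT σ
    · rw [← Set.image_univ, Set.ncard_image_of_injective, Set.ncard_univ]
      · exact hcard
      · intro σ τ h
        exact Subtype.ext (hext σ τ
          (hI1 _ ((P.inertia G).mul_mem ((P.inertia G).inv_mem σ.2) τ.2)) h)
  refine ⟨fun a ha hda => ?_, fun σ => ⟨hI1 σ, fun hσ => ?_⟩⟩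
  · have h1 := hxT a ((ha.of_isCoprime_of_dvd_right hQk).of_isCoprime_of_dvd_right
      (dvd_pow_self Q k.succ_ne_zero))
    rw [← hrange] at h1
    obtain ⟨σ, hσ⟩ := h1
    refine ⟨σ, ?_⟩
    rw [hm]
    refine (actsAs_of_generator hQ0 hfullQ hx hσ).of_isCoprime ((hI1 _ σ.2).congr ?_) hcop
    rwa [← neg_sub, dvd_neg]
  · have h1 := hsT σ
    rw [← hrange] at h1
    obtain ⟨τ, hτ⟩ := h1
    rw [← hext τ σ ?_ hτ]
    · exact τ.2
    · have h2 := (hI1 _ ((P.inertia G).inv_mem τ.2)).mul hσ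
      rwa [one_mul] at h2

variable (G) in
/-- Every class prime to `m` is realised by the Galois group on the `m`-torsion. -/
theorem exists_actsAs {m : F[X]} (hm0 : m ≠ 0)
    (hfull : FullTorsion R m) (hfaith : ∀ σ : G, ActsAs (R := R) σ m 1 → σ = 1)
    {a : F[X]} (ha : IsCoprime a m) : ∃ σ : G, ActsAs (R := R) σ m a := by
  classical
  have hone : ∀ a, m ∣ a - 1 → ∃ σ : G, ActsAs (R := R) σ m a := by
    intro a h
    refine ⟨1, ActsAs.congr (a := 1) (fun x _ => by rw [one_smul, cact_one]) ?_⟩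
    rwa [← neg_sub, dvd_neg]
  -- Induction on d over coprime factorizations, realising only classes that are 1 modulo the
  -- complementary factor e; the case e = 1 is the claim. Prime powers come from inertia, products
  -- from the Chinese remainder theorem.
  have key : ∀ d e : F[X], m = d * e → IsCoprime d e → ∀ a, IsCoprime a m → e ∣ a - 1 →
      ∃ σ : G, ActsAs (R := R) σ m a := by
    intro d
    induction d using UniqueFactorizationMonoid.induction_on_coprime with
    | h0 => intro e he; exact absurd (by rw [he, zero_mul]) hm0
    | @h1 u hu =>
      intro e he _ a _ hea
      exact hone a (by rw [he]; exact (associated_unit_mul_left e u hu).dvd.trans hea)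
    | @hpr p i hp =>
      intro e he hpe a ha hea
      rcases i with _ | i
      · exact hone a (by rw [he, pow_zero, one_mul]; exact hea)
      -- The inertia argument needs a monic prime; the unit lost in normalizing p is absorbed into
      -- the complementary factor.
      · have hass : Associated p (normalize p) := (normalize_associated p).symm
        have hirr : Irreducible (normalize p) := hass.irreducible hp.irreducible
        have hmon : (normalize p).Monic := Polynomial.monic_normalize hp.ne_zero
        obtain ⟨u, hu⟩ := hass.symm.pow_pow (n := i + 1)
        have hmax := isMaximal_span hirr
        obtain ⟨⟨P, hP1, hP2⟩⟩ :=
          (inferInstance : Nonempty ((Ideal.span {normalize p}).primesOver R))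
        refine (inertia_structure (k := i) (m' := (u : F[X]) * e) ?_ hfull hfaith hirr hmon ?_ P).1 a ha
          (u.isUnit.mul_left_dvd.2 hea)
        · rw [he, ← hu, mul_assoc]
        · rw [u.isUnit.dvd_mul_left, ← hass.dvd_iff_dvd_left]
          intro h
          exact hp.not_isUnit (hpe.isUnit_of_dvd' (dvd_pow_self p i.succ_ne_zero) h)
    | @hcp x y hxy ihx ihy =>
      intro e he hcop a ha hea
      have hxy' := hxy.isCoprime
      have hxe : IsCoprime x e := hcop.of_mul_left_left
      have hye : IsCoprime y e := hcop.of_mul_left_right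
      have crt : ∀ z w : F[X], m = z * w → IsCoprime z w → ∃ b, z ∣ b - a ∧ w ∣ b - 1 ∧
          IsCoprime b m := by
        rintro z w hzw ⟨u, v, huv⟩
        have e1 : a * v * w + u * z = a + z * (u * (1 - a)) := by linear_combination a * huv
        have e2 : a * v * w + u * z = 1 + w * (v * (a - 1)) := by linear_combination huv
        refine ⟨a * v * w + u * z, ?_, ?_, ?_⟩
        · rw [e1, add_sub_cancel_left]; exact dvd_mul_right _ _
        · rw [e2, add_sub_cancel_left]; exact dvd_mul_right _ _
        · rw [hzw]
          rw [hzw] at ha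
          refine IsCoprime.mul_right ?_ ?_
          · rw [e1]; exact (ha.of_mul_right_left).add_mul_left_left _
          · rw [e2]; exact isCoprime_one_left.add_mul_left_left _
      have hx1 : m = x * (y * e) := by rw [he, mul_assoc]
      have hy1 : m = y * (x * e) := by rw [he]; ring
      obtain ⟨b, hb1, hb2, hb3⟩ := crt x (y * e) hx1 (hxy'.mul_right hxe)
      obtain ⟨c, hc1, hc2, hc3⟩ := crt y (x * e) hy1 (hxy'.symm.mul_right hye)
      obtain ⟨σ, hσ⟩ := ihx (y * e) hx1 (hxy'.mul_right hxe) b hb3 hb2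
      obtain ⟨τ, hτ⟩ := ihy (x * e) hy1 (hxy'.symm.mul_right hye) c hc3 hc2
      refine ⟨σ * τ, (hσ.mul hτ).congr ?_⟩
      rw [he]
      have d1 : ∀ z, z ∣ b - a → z ∣ c - 1 → z ∣ b * c - a := by
        rintro z ⟨s, hs⟩ ⟨t, ht⟩
        exact ⟨s * c + a * t, by linear_combination c * hs + a * ht⟩
      have d2 : ∀ z, z ∣ b - 1 → z ∣ c - a → z ∣ b * c - a := by
        rintro z ⟨s, hs⟩ ⟨t, ht⟩
        exact ⟨s * c + t, by linear_combination c * hs + ht⟩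
      have hba := dvd_sub ((dvd_mul_left e y).trans hb2) hea
      rw [sub_sub_sub_cancel_right] at hba
      have d3 : e ∣ b * c - a := d1 e hba ((dvd_mul_left e x).trans hc2)
      exact hcop.mul_dvd (hxy'.mul_dvd (d1 x hb1 ((dvd_mul_right x e).trans hc2))
        (d2 y ((dvd_mul_right y e).trans hb2) hc1)) d3
  exact key m 1 (mul_one m).symm isCoprime_one_right a ha (one_dvd _)

/-- Inertia and decomposition groups of a prime above `Q` in terms of the Galois representation on
the torsion prime to `Q`. -/
theorem exists_galoisRep_decomposition {m Q m' : F[X]} {k : ℕ} (hm : m = Q ^ (k + 1) * m')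
    (hm0 : m ≠ 0) (hfull : FullTorsion R m) (hfaith : ∀ σ : G, ActsAs (R := R) σ m 1 → σ = 1)
    (hQ : Irreducible Q) (hQm : Q.Monic) (hQm' : IsCoprime Q m') (P : Ideal R) [P.IsPrime]
    [P.LiesOver (Ideal.span {Q})] :
    ∃ ρ : G →* (F[X] ⧸ Ideal.span {m'})ˣ, Function.Surjective ρ ∧
      (∀ (σ : G) (a : F[X]),
        (ρ σ : F[X] ⧸ Ideal.span {m'}) = Ideal.Quotient.mk _ a ↔ ActsAs (R := R) σ m' a) ∧
      P.inertia G = ρ.ker ∧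
      MulAction.stabilizer G P = (Subgroup.zpowers (unitMk hQm')).comap ρ := by
  have hdvd : m' ∣ m := ⟨Q ^ (k + 1), by rw [hm, mul_comm]⟩
  have hm'0 : m' ≠ 0 := fun h => hm0 (by rw [hm, h, mul_zero])
  have hQn : ¬ Q ∣ m' := hQ.coprime_iff_not_dvd.1 hQm'
  obtain ⟨ρ, hρ⟩ := exists_galoisRep G hm'0 (hfull.of_dvd hdvd)
  have hI : P.inertia G = ρ.ker := by
    ext σ
    rw [(inertia_structure hm hfull hfaith hQ hQm hQn P).2 σ, ← hρ, MonoidHom.mem_ker,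
      map_one, Units.ext_iff, Units.val_one]
  have hmax := isMaximal_span hQ
  have := finite_quotient_span hQ.ne_zero
  have := finite_quotient_of_liesOver hQ P
  have := isMaximal_of_liesOver hQ P
  -- A Frobenius at P maps to the class of Q, and together with inertia it generates the
  -- decomposition group.
  obtain ⟨φ, hφ⟩ := IsArithFrobAt.exists_of_isInvariant F[X] G P
  have hφρ : ρ φ = unitMk hQm' :=
    Units.ext ((hρ φ Q).2 (actsAs_frobenius hQ hQm hQn P hφ))
  refine ⟨ρ, fun u => ?_, hρ, hI, le_antisymm (fun σ hσ => ?_) (fun σ hσ => ?_)⟩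
  · obtain ⟨a, ha, rfl⟩ := exists_eq_unitMk u
    obtain ⟨b, hb, hd⟩ := exists_isCoprime_dvd_sub hm0 ha
    obtain ⟨σ, hσ⟩ := exists_actsAs G hm0 hfull hfaith hb
    exact ⟨σ, Units.ext ((hρ σ a).2 ((hσ.of_dvd hdvd).congr hd))⟩
  · obtain ⟨i, hi⟩ := exists_mul_frobenius_mem_inertia (Ideal.span {Q}) P φ hφ hσ
    rw [hI, MonoidHom.mem_ker, map_mul, map_inv, map_pow, hφρ, mul_inv_eq_one] at hi
    rw [Subgroup.mem_comap, hi]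
    exact Subgroup.pow_mem _ (Subgroup.mem_zpowers _) i
  · obtain ⟨i, hi⟩ := hσ
    have h1 : σ * (φ ^ i)⁻¹ ∈ P.inertia G := by
      rw [hI, MonoidHom.mem_ker, map_mul, map_inv, map_zpow, hφρ, mul_inv_eq_one]
      exact hi.symm
    have h2 := Ideal.inertia_le_stabilizer P h1
    have h3 : φ ∈ MulAction.stabilizer G P := hφ.mem_stabilizer
    have := mul_mem h2 (zpow_mem h3 i)
    rwa [inv_mul_cancel_right] at this

end Decomposition

/-! ### Passage to integral closures in intermediate fields -/

section Splitting

open scoped Pointwise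

set_option linter.unusedSectionVars false

variable {F : Type*} [Field F] [Fintype F]

theorem faithfulSMul_integralClosure {E : Type*} [Field E] [Algebra (RatFunc F) E]
    [Algebra F[X] E] [IsScalarTower F[X] (RatFunc F) E] :
    FaithfulSMul F[X] (integralClosure F[X] E) := by
  rw [faithfulSMul_iff_algebraMap_injective]
  intro x y h
  have h1 : algebraMap F[X] E x = algebraMap F[X] E y := congrArg Subtype.val h
  rw [IsScalarTower.algebraMap_apply F[X] (RatFunc F) E,
    IsScalarTower.algebraMap_apply F[X] (RatFunc F) E] at h1
  exact IsFractionRing.injective F[X] (RatFunc F) ((algebraMap (RatFunc F) E).injective h1)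

section Tower

variable {L E : Type*} [Field L] [Field E] [Algebra (RatFunc F) E] [Algebra (RatFunc F) L]
  [Algebra L E] [IsScalarTower (RatFunc F) L E] [Algebra F[X] E] [Algebra F[X] L]
  [IsScalarTower F[X] (RatFunc F) E] [IsScalarTower F[X] (RatFunc F) L]
  [FiniteDimensional (RatFunc F) E] [FiniteDimensional (RatFunc F) L]
  [IsGalois (RatFunc F) E] [IsGalois (RatFunc F) L]

theorem isGaloisGroup_integralClosure :
    IsGaloisGroup (E ≃ₐ[RatFunc F] E) F[X] (integralClosure F[X] E) := by
  have := IsIntegralClosure.isFractionRing_of_finite_extension F[X] (RatFunc F) E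
    (integralClosure F[X] E)
  exact IsGaloisGroup.of_isFractionRing _ F[X] (integralClosure F[X] E) (RatFunc F) E

/-- The splitting of `Q` in an intermediate field, in terms of an abelian representation of the
Galois group which is trivial exactly on the inertia group. -/
theorem residueDegree_and_numPrimesOver_eq (H : Subgroup (E ≃ₐ[RatFunc F] E))
    [IsGaloisGroup H L E] {Q : F[X]} (hQ : Irreducible Q) (P : Ideal (integralClosure F[X] E))
    [P.IsPrime] [P.LiesOver (Ideal.span {Q})] {Γ : Type*} [CommGroup Γ] [Finite Γ]
    (ρ : (E ≃ₐ[RatFunc F] E) →* Γ) (hρ : Function.Surjective ρ) (γ : Γ)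
    (hI : P.inertia (E ≃ₐ[RatFunc F] E) = ρ.ker)
    (hD : MulAction.stabilizer (E ≃ₐ[RatFunc F] E) P = (Subgroup.zpowers γ).comap ρ) :
    residueDegree L Q = orderOf (γ : Γ ⧸ H.map ρ) ∧
      residueDegree L Q * numPrimesOver L Q = Nat.card (Γ ⧸ H.map ρ) := by
  have tow : IsScalarTower F[X] L E := IsScalarTower.of_algebraMap_eq fun x => by
    rw [IsScalarTower.algebraMap_apply F[X] (RatFunc F) E,
      IsScalarTower.algebraMap_apply F[X] (RatFunc F) L,
      ← IsScalarTower.algebraMap_apply (RatFunc F) L E]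
  have fC := IsIntegralClosure.isFractionRing_of_finite_extension F[X] (RatFunc F) E
    (integralClosure F[X] E)
  have fB := IsIntegralClosure.isFractionRing_of_finite_extension F[X] (RatFunc F) L
    (integralClosure F[X] L)
  have gC : IsGaloisGroup (E ≃ₐ[RatFunc F] E) F[X] (integralClosure F[X] E) :=
    isGaloisGroup_integralClosure
  have gB : IsGaloisGroup (L ≃ₐ[RatFunc F] L) F[X] (integralClosure F[X] L) :=
    isGaloisGroup_integralClosure
  let φ : integralClosure F[X] L →ₐ[F[X]] integralClosure F[X] E :=
    (IsScalarTower.toAlgHom F[X] L E).mapIntegralClosure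
  let _ : Algebra (integralClosure F[X] L) (integralClosure F[X] E) := φ.toRingHom.toAlgebra
  have t1 : IsScalarTower F[X] (integralClosure F[X] L) (integralClosure F[X] E) :=
    IsScalarTower.of_algebraMap_eq fun x => (φ.commutes x).symm
  have t2 : IsScalarTower (integralClosure F[X] L) (integralClosure F[X] E) E :=
    IsScalarTower.of_algebraMap_eq fun x => rfl
  have dC : IsDedekindDomain (integralClosure F[X] E) :=
    integralClosure.isDedekindDomain F[X] (RatFunc F) E
  have dB : IsDedekindDomain (integralClosure F[X] L) :=
    integralClosure.isDedekindDomain F[X] (RatFunc F) L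
  have finC : Module.Finite F[X] (integralClosure F[X] E) :=
    IsIntegralClosure.finite F[X] (RatFunc F) E _
  have finB : Module.Finite F[X] (integralClosure F[X] L) :=
    IsIntegralClosure.finite F[X] (RatFunc F) L _
  have intBC : Algebra.IsIntegral (integralClosure F[X] L) (integralClosure F[X] E) :=
    Algebra.IsIntegral.tower_top F[X]
  have sC : FaithfulSMul F[X] (integralClosure F[X] E) := faithfulSMul_integralClosure
  have sB : FaithfulSMul F[X] (integralClosure F[X] L) := faithfulSMul_integralClosure
  have sBC : FaithfulSMul (integralClosure F[X] L) (integralClosure F[X] E) := by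
    rw [faithfulSMul_iff_algebraMap_injective]
    intro x y h
    exact Subtype.ext ((algebraMap L E).injective (congrArg Subtype.val h))
  have gH : IsGaloisGroup H (integralClosure F[X] L) (integralClosure F[X] E) :=
    IsGaloisGroup.of_isFractionRing H _ _ L E
  -- The residue fields below are finite, hence perfect, as the group-order formulas require.
  have hmax := isMaximal_span hQ
  have := finite_quotient_span hQ.ne_zero
  have := finite_residueField (Ideal.span {Q})
  have : (P.under (integralClosure F[X] L)).LiesOver (Ideal.span {Q}) := inferInstance
  have := finite_quotient_of_liesOver hQ (P.under (integralClosure F[X] L))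
  have := isMaximal_of_liesOver hQ (P.under (integralClosure F[X] L))
  have := finite_residueField (P.under (integralClosure F[X] L))
  exact inertiaDegIn_and_ncard_of_stabilizer_eq (L ≃ₐ[RatFunc F] L) H (Ideal.span {Q}) P ρ hρ γ
    hI hD

end Tower
end Splitting

/-! ### The cyclotomic function field and its real subfield -/

section Cyclotomic

open scoped Pointwise

set_option linter.unusedSectionVars false

variable {F : Type*} [Field F] [Fintype F]

/-- Lets K_m be treated, like K_m^+, as the fixed field of a subgroup. -/
theorem isGaloisGroup_bot {G E : Type*} [Group G] [Field E] [MulSemiringAction G E] :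
    IsGaloisGroup (⊥ : Subgroup G) E E where
  faithful := ⟨fun _ => Subsingleton.elim _ _⟩
  commutes := ⟨fun σ x y => by rw [Subsingleton.elim σ 1, one_smul, one_smul]⟩
  isInvariant := ⟨fun x _ => ⟨x, rfl⟩⟩

theorem mem_torsion {m : F[X]} {x : Kac F} : x ∈ torsion m ↔ x ∈ ctors (Kac F) m := by
  rw [mem_ctors, ← carlitzAct_eq_cact]; rfl

theorem algebraMap_ratFunc_ne_zero {E : Type*} [Field E] [Algebra (RatFunc F) E]
    [Algebra F[X] E] [IsScalarTower F[X] (RatFunc F) E] {a : F[X]} (ha : a ≠ 0) :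
    algebraMap F[X] E a ≠ 0 := by
  rw [IsScalarTower.algebraMap_apply F[X] (RatFunc F) E]
  exact (_root_.map_ne_zero _).2 (RatFunc.algebraMap_ne_zero ha)

theorem torsion_eq_rootSet {m : F[X]} (hm : m.Monic) :
    torsion m = ((cpoly m).map (algebraMap F[X] (RatFunc F))).rootSet (Kac F) := by
  ext x
  rw [mem_rootSet', mem_torsion, mem_ctors, ← aeval_cpoly, aeval_map_algebraMap,
    Polynomial.map_map]
  exact ⟨fun h => ⟨((cpoly_monic_natDegree hm).1.map _).ne_zero, h⟩, fun h => h.2⟩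

theorem separable_map_cpoly {m : F[X]} (hm : m ≠ 0) :
    ((cpoly m).map (algebraMap F[X] (RatFunc F))).Separable := by
  rw [Polynomial.separable_def, derivative_map, derivative_cpoly, map_C]
  exact (isCoprime_one_right).of_isCoprime_of_dvd_right
    (Polynomial.isUnit_C.2 (RatFunc.algebraMap_ne_zero hm).isUnit).dvd

theorem isSplittingField_cyclotomicField {m : F[X]} (hm : m.Monic) :
    IsSplittingField (RatFunc F) (cyclotomicField m)
      ((cpoly m).map (algebraMap F[X] (RatFunc F))) := by
  unfold cyclotomicField
  rw [torsion_eq_rootSet hm]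
  exact IntermediateField.adjoin_rootSet_isSplittingField (IsAlgClosed.splits _)

theorem isGalois_cyclotomicField {m : F[X]} (hm : m.Monic) :
    IsGalois (RatFunc F) (cyclotomicField m) :=
  have := isSplittingField_cyclotomicField hm
  IsGalois.of_separable_splitting_field (separable_map_cpoly hm.ne_zero)

theorem finiteDimensional_cyclotomicField {m : F[X]} (hm : m.Monic) :
    FiniteDimensional (RatFunc F) (cyclotomicField m) :=
  have := isSplittingField_cyclotomicField hm
  IsSplittingField.finiteDimensional _ ((cpoly m).map (algebraMap F[X] (RatFunc F)))

/-- The ring of integers of the cyclotomic function field. -/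
abbrev integerRing (m : F[X]) : Type _ := integralClosure F[X] (cyclotomicField m)

instance (m : F[X]) : Algebra F (integerRing m) :=
  ((algebraMap F[X] (integerRing m)).comp C).toAlgebra

instance (m : F[X]) : IsScalarTower F F[X] (integerRing m) :=
  IsScalarTower.of_algebraMap_eq fun _ => rfl

instance (m : F[X]) : IsScalarTower F[X] (cyclotomicField m) (Kac F) :=
  IsScalarTower.of_algebraMap_eq fun x => by
    rw [IsScalarTower.algebraMap_apply F[X] (RatFunc F) (Kac F),
      IsScalarTower.algebraMap_apply F[X] (RatFunc F) (cyclotomicField m),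
      ← IsScalarTower.algebraMap_apply (RatFunc F) (cyclotomicField m) (Kac F)]

/-- The inclusion of the ring of integers into the algebraic closure. -/
def integerInclusion (m : F[X]) : integerRing m →ₐ[F[X]] Kac F :=
  (IsScalarTower.toAlgHom F[X] (cyclotomicField m) (Kac F)).comp
    (integralClosure F[X] (cyclotomicField m)).val

theorem integerInclusion_injective (m : F[X]) : Function.Injective (integerInclusion m) :=
  fun _ _ h => Subtype.ext (Subtype.ext h)

theorem exists_integerInclusion_eq {m : F[X]} (hm : m.Monic) {x : Kac F}
    (hx : x ∈ ctors (Kac F) m) : ∃ y : integerRing m, integerInclusion m y = x := by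
  have h1 : x ∈ cyclotomicField m := IntermediateField.subset_adjoin _ _ (mem_torsion.2 hx)
  have h2 : IsIntegral F[X] x :=
    ⟨cpoly m, (cpoly_monic_natDegree hm).1, (aeval_cpoly m x).trans hx⟩
  refine ⟨⟨⟨x, h1⟩, ?_⟩, rfl⟩
  exact (isIntegral_algHom_iff (IsScalarTower.toAlgHom F[X] (cyclotomicField m) (Kac F))
    (algebraMap (cyclotomicField m) (Kac F)).injective).1 h2

theorem integerInclusion_mem_ctors {m a : F[X]} {x : integerRing m} :
    integerInclusion m x ∈ ctors (Kac F) a ↔ x ∈ ctors (integerRing m) a := by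
  rw [mem_ctors, mem_ctors, ← map_cact, map_eq_zero_iff _ (integerInclusion_injective m)]

/-- Torsion points are roots of monic polynomials over A, hence integral, so none is lost in passing
from the algebraic closure to the integers of K_m. -/
theorem fullTorsion_integerRing {m : F[X]} (hm : m.Monic) : FullTorsion (integerRing m) m := by
  classical
  intro a ha
  have ha0 : a ≠ 0 := ne_zero_of_dvd_ne_zero hm.ne_zero ha
  have h1 : integerInclusion m '' ctors (integerRing m) a = ctors (Kac F) a := by
    refine Set.Subset.antisymm ?_ fun x hx => ?_
    · rintro _ ⟨x, hx, rfl⟩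
      exact integerInclusion_mem_ctors.2 hx
    · obtain ⟨y, rfl⟩ := exists_integerInclusion_eq hm (ctors_mono ha hx)
      exact ⟨y, integerInclusion_mem_ctors.1 hx, rfl⟩
  have h2 : ctors (Kac F) a = ctors (Kac F) (normalize a) :=
    Set.Subset.antisymm (ctors_mono (normalize_associated a).symm.dvd)
      (ctors_mono (normalize_associated a).dvd)
  rw [← Set.ncard_image_of_injective _ (integerInclusion_injective m), h1, h2,
    ncard_ctors_eq (monic_normalize ha0)
      (algebraMap_ratFunc_ne_zero (mt normalize_eq_zero.1 ha0)),
    natDegree_eq_of_degree_eq degree_normalize]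

theorem integerInclusion_smul {m : F[X]}
    (σ : cyclotomicField m ≃ₐ[RatFunc F] cyclotomicField m) (x : integerRing m) :
    integerInclusion m (σ • x) = ((σ x : cyclotomicField m) : Kac F) := rfl

theorem eq_one_of_actsAs_one {m : F[X]} (hm : m.Monic)
    (σ : cyclotomicField m ≃ₐ[RatFunc F] cyclotomicField m)
    (h : ActsAs (R := integerRing m) σ m 1) : σ = 1 := by
  have h1 : (σ : cyclotomicField m →ₐ[RatFunc F] cyclotomicField m) = AlgHom.id _ _ := by
    refine IntermediateField.algHom_ext_of_eq_adjoin (RatFunc F)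
      (S := cyclotomicField m) (s := torsion m) rfl fun x hx => ?_
    obtain ⟨y, hy⟩ := exists_integerInclusion_eq hm (mem_torsion.1 hx)
    have h2 := h y (integerInclusion_mem_ctors.1 (by rw [hy]; exact mem_torsion.1 hx))
    have h3 := congrArg (integerInclusion m) h2
    rw [cact_one, integerInclusion_smul] at h3
    have h4 : (y : cyclotomicField m) = ⟨x, IntermediateField.subset_adjoin _ _ hx⟩ :=
      Subtype.ext hy
    rw [h4] at h3
    exact Subtype.ext (h3.trans hy)
  exact AlgEquiv.ext fun x => DFunLike.congr_fun h1 x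

theorem mem_constantSubgroup_iff {m : F[X]} (hm : m.Monic)
    (σ : cyclotomicField m ≃ₐ[RatFunc F] cyclotomicField m) :
    σ ∈ constantSubgroup m ↔ ∃ c : Fˣ, ActsAs (R := integerRing m) σ m (C (c : F)) := by
  refine exists_congr fun c => ⟨fun h x hx => ?_, fun h x hx => ?_⟩
  · refine integerInclusion_injective m ?_
    rw [integerInclusion_smul, h x (mem_torsion.2 (integerInclusion_mem_ctors.2 hx)),
      carlitzAct_eq_cact, map_cact]
    rfl
  · obtain ⟨y, hy⟩ := exists_integerInclusion_eq hm (mem_torsion.1 hx)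
    have h4 : (y : cyclotomicField m) = x := Subtype.ext hy
    subst h4
    have h2 := h y (integerInclusion_mem_ctors.1 (mem_torsion.1 hx))
    have h3 := congrArg (integerInclusion m) h2
    rwa [integerInclusion_smul, map_cact, ← carlitzAct_eq_cact] at h3

/-- The representation on the whole m-torsion is faithful with commutative target. Commutativity
makes the constant subgroup normal, so that K_m^+/k is Galois. -/
theorem mul_comm_of_actsAs {m : F[X]} (hm : m.Monic)
    (σ τ : cyclotomicField m ≃ₐ[RatFunc F] cyclotomicField m) : σ * τ = τ * σ := by
  obtain ⟨ρ, hρ⟩ := exists_galoisRep (cyclotomicField m ≃ₐ[RatFunc F] cyclotomicField m)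
    hm.ne_zero (fullTorsion_integerRing hm)
  have hinj : Function.Injective ρ := (injective_iff_map_eq_one ρ).2 fun σ hσ =>
    eq_one_of_actsAs_one hm σ ((hρ σ 1).1 (by rw [hσ, Units.val_one, map_one]))
  exact hinj (by rw [map_mul, map_mul, mul_comm])

theorem normal_constantSubgroup {m : F[X]} (hm : m.Monic) : (constantSubgroup m).Normal :=
  ⟨fun n hn g => by rwa [mul_comm_of_actsAs hm g n, mul_inv_cancel_right]⟩

/-- The image of the constant subgroup under the representation on the prime-to-`Q` torsion. -/
theorem map_constantSubgroup {m n : F[X]} (hm : m.Monic) (hn : n ∣ m)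
    (ρ : (cyclotomicField m ≃ₐ[RatFunc F] cyclotomicField m) →* (F[X] ⧸ Ideal.span {n})ˣ)
    (hρ : ∀ σ (a : F[X]), (ρ σ : F[X] ⧸ Ideal.span {n}) = Ideal.Quotient.mk _ a ↔
      ActsAs (R := integerRing m) σ n a)
    (hex : ∀ c : Fˣ, ∃ σ : cyclotomicField m ≃ₐ[RatFunc F] cyclotomicField m,
      ActsAs (R := integerRing m) σ m (C (c : F))) :
    (constantSubgroup m).map ρ = constantUnits n := by
  ext u
  constructor
  · rintro ⟨σ, hσ, rfl⟩
    obtain ⟨c, hc⟩ := (mem_constantSubgroup_iff hm σ).1 hσ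
    exact ⟨c, Units.ext ((hρ σ _).2 (hc.of_dvd hn)).symm⟩
  · rintro ⟨c, rfl⟩
    obtain ⟨σ, hσ⟩ := hex c
    exact ⟨σ, (mem_constantSubgroup_iff hm σ).2 ⟨c, hσ⟩,
      Units.ext ((hρ σ _).2 (hσ.of_dvd hn))⟩

/-- Splitting of `Q` in the cyclotomic function field and its maximal real subfield. -/
theorem splitting_cyclotomicField {m Q m' : F[X]} {k : ℕ} (hmm : m.Monic)
    (hm : m = Q ^ (k + 1) * m') (hQ : Irreducible Q) (hQm : Q.Monic) (hQm' : IsCoprime Q m') :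
    (residueDegree (cyclotomicField m) Q =
        orderOf ((unitMk hQm' : (F[X] ⧸ Ideal.span {m'})ˣ) : (F[X] ⧸ Ideal.span {m'})ˣ ⧸
          (⊥ : Subgroup (F[X] ⧸ Ideal.span {m'})ˣ)) ∧
      residueDegree (cyclotomicField m) Q * numPrimesOver (cyclotomicField m) Q =
        Nat.card ((F[X] ⧸ Ideal.span {m'})ˣ ⧸ (⊥ : Subgroup (F[X] ⧸ Ideal.span {m'})ˣ))) ∧
    (residueDegree (maximalRealSubfield m) Q =
        orderOf ((unitMk hQm' : (F[X] ⧸ Ideal.span {m'})ˣ) : (F[X] ⧸ Ideal.span {m'})ˣ ⧸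
          constantUnits m') ∧
      residueDegree (maximalRealSubfield m) Q * numPrimesOver (maximalRealSubfield m) Q =
        Nat.card ((F[X] ⧸ Ideal.span {m'})ˣ ⧸ constantUnits m')) := by
  have hm0 := hmm.ne_zero
  have hm'0 : m' ≠ 0 := fun h => hm0 (by rw [hm, h, mul_zero])
  have := isGalois_cyclotomicField hmm
  have := finiteDimensional_cyclotomicField hmm
  have := normal_constantSubgroup hmm
  have := finite_quotient_span hm'0
  have : IsGalois (RatFunc F) (maximalRealSubfield m) :=
    IsGalois.of_fixedField_normal_subgroup (constantSubgroup m)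
  have dR : IsDedekindDomain (integerRing m) :=
    integralClosure.isDedekindDomain F[X] (RatFunc F) _
  have finR : Module.Finite F[X] (integerRing m) :=
    IsIntegralClosure.finite F[X] (RatFunc F) (cyclotomicField m) _
  have sR : FaithfulSMul F[X] (integerRing m) := faithfulSMul_integralClosure
  have gR : IsGaloisGroup (cyclotomicField m ≃ₐ[RatFunc F] cyclotomicField m) F[X]
    (integerRing m) := isGaloisGroup_integralClosure
  have hmax := isMaximal_span hQ
  obtain ⟨⟨P, hP1, hP2⟩⟩ :=
    (inferInstance : Nonempty ((Ideal.span {Q}).primesOver (integerRing m)))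
  have hfull := fullTorsion_integerRing hmm
  obtain ⟨ρ, hsurj, hρ, hI, hD⟩ := exists_galoisRep_decomposition
    (G := cyclotomicField m ≃ₐ[RatFunc F] cyclotomicField m) hm hm0 hfull
    (eq_one_of_actsAs_one hmm) hQ hQm hQm' P
  have g1 : IsGaloisGroup (⊥ : Subgroup (cyclotomicField m ≃ₐ[RatFunc F] cyclotomicField m))
    (cyclotomicField m) (cyclotomicField m) := isGaloisGroup_bot
  have g2 : IsGaloisGroup (constantSubgroup m) (maximalRealSubfield m) (cyclotomicField m) :=
    IsGaloisGroup.subgroup (cyclotomicField m ≃ₐ[RatFunc F] cyclotomicField m) (RatFunc F)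
      (cyclotomicField m) (constantSubgroup m)
  refine ⟨?_, ?_⟩
  · have h := residueDegree_and_numPrimesOver_eq (L := cyclotomicField m) ⊥ hQ P ρ hsurj _ hI hD
    rwa [Subgroup.map_bot] at h
  · have h := residueDegree_and_numPrimesOver_eq (L := maximalRealSubfield m)
      (constantSubgroup m) hQ P ρ hsurj _ hI hD
    rwa [map_constantSubgroup hmm ⟨Q ^ (k + 1), by rw [hm, mul_comm]⟩ ρ hρ fun c =>
      exists_actsAs _ hm0 hfull (eq_one_of_actsAs_one hmm)
        (isCoprime_C_left c.ne_zero _)] at h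

end Cyclotomic

/-! ### Comparison of Euler factors with splitting data -/

section EulerFactors

variable {F : Type*} [Field F]

/-- The Euler factors at `Q` of all characters, and of the even characters. -/
theorem finprod_eulerFactors_eq [Fintype F] {m Q : F[X]} (hm : m.Monic)
    (hQ : Q ∈ primeDivisors m) :
    (∏ᶠ χ ∈ charGroup m, (1 - C (χ.eval Q) * X ^ Q.natDegree) =
      (1 - X ^ (residueDegree (cyclotomicField m) Q * Q.natDegree)) ^
        numPrimesOver (cyclotomicField m) Q) ∧
    (∏ᶠ χ ∈ evenChars m, (1 - C (χ.eval Q) * X ^ Q.natDegree) =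
      (1 - X ^ (residueDegree (maximalRealSubfield m) Q * Q.natDegree)) ^
        numPrimesOver (maximalRealSubfield m) Q) ∧
    residueDegree (maximalRealSubfield m) Q ≠ 0 := by
  obtain ⟨hQm, hQi, hQd⟩ := hQ
  obtain ⟨m', hmk, hn⟩ := (FiniteMultiplicity.of_not_isUnit hQi.not_isUnit
    hm.ne_zero).exists_eq_pow_mul_and_not_dvd
  obtain ⟨k, hk⟩ : ∃ k, multiplicity Q m = k + 1 := by
    refine Nat.exists_eq_succ_of_ne_zero fun h => hn ?_
    rw [h, pow_zero, one_mul] at hmk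
    rwa [← hmk]
  rw [hk] at hmk
  have hcop : IsCoprime Q m' := hQi.coprime_iff_not_dvd.2 hn
  have hm' : m'.Monic := (hQm.pow (k + 1)).of_mul_monic_left (hmk ▸ hm)
  have := finite_quotient_span hm'.ne_zero
  -- U is trivial for all characters and the group of constants for the even ones. Since fg is the
  -- order of the quotient by U, the exponent in the character product is g.
  have key : ∀ (U : Subgroup (F[X] ⧸ Ideal.span {m'})ˣ) (p : PrimitiveCharacter F → Prop)
      (f g : ℕ) (_ : ∀ χ, χ ∈ {χ | χ ∈ charGroup m' ∧ p χ} ↔ χ.conductor ∣ m' ∧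
        ∀ b (hb : IsCoprime b m'), unitMk hb ∈ U → χ.eval b = 1)
      (_ : f = orderOf (unitMk hcop : (F[X] ⧸ Ideal.span {m'})ˣ ⧸ U))
      (_ : f * g = Nat.card ((F[X] ⧸ Ideal.span {m'})ˣ ⧸ U)),
      ∏ᶠ χ ∈ {χ | χ ∈ charGroup m ∧ p χ}, (1 - C (χ.eval Q) * X ^ Q.natDegree) =
        (1 - X ^ (f * Q.natDegree)) ^ g ∧ f ≠ 0 := by
    intro U p f g hs hf hfg
    have hpos : f ≠ 0 := hf ▸ (orderOf_pos _).ne'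
    have h1 := finprod_mem_mul_pow_eq (R := ℂ[X]) (Q := Q) (m' := m') (k := k + 1)
      (X ^ Q.natDegree) p
    rw [← hmk, finprod_mem_charGroup_eq hm' hcop
      (fun z => 1 - algebraMap ℂ ℂ[X] z * X ^ Q.natDegree) U _ hs,
      finprod_one_sub_monoidHom_trivialOn, ← hf, ← hfg, Nat.mul_div_cancel_left _
      (Nat.pos_of_ne_zero hpos), ← pow_mul, mul_comm Q.natDegree] at h1
    exact ⟨h1, hpos⟩
  obtain ⟨⟨h1, h2⟩, h3, h4⟩ := splitting_cyclotomicField hm hmk hQi hQm hcop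
  have hall := key ⊥ (fun _ => True) _ _ (fun χ => by
    rw [← mem_charGroup_iff_trivialOn_bot]; simp) h1 h2
  have heven := key (constantUnits m') (fun χ => ∀ c : F, c ≠ 0 → χ.eval (C c) = 1) _ _
    mem_evenChars_iff_trivialOn_constantUnits h3 h4
  refine ⟨?_, heven⟩
  have h := hall.1
  simp only [and_true, Set.ofPred_mem_eq] at h
  exact h

end EulerFactors

/-! ### Odd characters and the prime power case -/

section OddCharacters

variable {F : Type*} [Field F]

theorem JMinus_eq_finprod [Finite F] {m : F[X]} (hm : m ≠ 0) :
    JMinus m = ∏ᶠ Q ∈ primeDivisors m, ∏ᶠ χ ∈ oddChars m,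
      (1 - C (χ.eval Q) * X ^ Q.natDegree) :=
  finprod_mem_comm _ ((charGroup_finite hm).subset Set.sdiff_subset) (primeDivisors_finite hm)

theorem finprod_evenChars_mul_oddChars [Finite F] {m : F[X]} (hm : m ≠ 0) {M : Type*}
    [CommMonoid M] (f : PrimitiveCharacter F → M) :
    (∏ᶠ χ ∈ evenChars m, f χ) * ∏ᶠ χ ∈ oddChars m, f χ = ∏ᶠ χ ∈ charGroup m, f χ :=
  finprod_mem_mul_sdiff (fun _ h => h.1) (charGroup_finite hm)

/-- If χ(Q) ≠ 0, the conductor is prime to the only prime of m yet divides m, so it is 1; then χ is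
trivial and hence even. -/
theorem PrimitiveCharacter.eval_eq_zero_of_isPrimePow {m Q : F[X]} (hm : IsPrimePow m)
    (hQ : Irreducible Q) (hQm : Q ∣ m) {χ : PrimitiveCharacter F} (hχ : χ ∈ oddChars m) :
    χ.eval Q = 0 := by
  by_contra h
  have hcop : IsCoprime Q χ.conductor := by
    by_contra h'
    exact h (χ.eval_of_not_isCoprime h')
  obtain ⟨p, n, hp, -, rfl⟩ := hm
  have hass : Associated Q p := hQ.prime.associated_of_dvd hp (hQ.prime.dvd_of_dvd_pow hQm)
  have h1 : IsCoprime χ.conductor (p ^ n) :=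
    ((hcop.of_isCoprime_of_dvd_left hass.symm.dvd).pow_left).symm
  have h2 : χ.conductor = 1 := χ.monic.eq_one_of_isUnit (h1.isUnit_of_dvd' dvd_rfl hχ.1)
  refine hχ.2 ⟨hχ.1, fun c _ => ?_⟩
  rw [χ.eval_eq_of_dvd_sub (b := 1) (by rw [h2]; exact one_dvd _), χ.eval_one]

theorem JMinus_eq_one_of_isPrimePow {m : F[X]} (hm : IsPrimePow m) : JMinus m = 1 :=
  finprod_mem_eq_one_of_forall_eq_one fun χ hχ =>
    finprod_mem_eq_one_of_forall_eq_one fun Q hQ => by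
      rw [χ.eval_eq_zero_of_isPrimePow hm hQ.2.1 hQ.2.2 hχ, C_0, zero_mul, sub_zero]

end OddCharacters

/-! ### Integrality and the final assembly -/

/-- A complex polynomial is integral if its product with a power of `1 - X ^ a` is. -/
theorem mem_lifts_of_one_sub_X_pow_mul_mem_lifts {a g : ℕ} (ha : a ≠ 0) {P : ℂ[X]}
    (h : (1 - X ^ a) ^ g * P ∈ lifts (Int.castRingHom ℂ)) : P ∈ lifts (Int.castRingHom ℂ) := by
  have hmon : ((X ^ a - 1 : ℤ[X]) ^ g).Monic := (monic_X_pow_sub_C 1 ha).pow g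
  have hmap : ((X ^ a - 1 : ℤ[X]) ^ g).map (Int.castRingHom ℂ) = (X ^ a - 1) ^ g := by simp
  have hneg : (1 - X ^ a : ℂ[X]) ^ g = (-1) ^ g * (X ^ a - 1) ^ g := by
    rw [← mul_pow, neg_one_mul, neg_sub]
  obtain ⟨N, hN⟩ := (mem_lifts _).1 h
  -- Divisibility by a monic integer polynomial descends from ℂ to ℤ.
  have hdvd : (X ^ a - 1 : ℤ[X]) ^ g ∣ N := by
    rw [← map_dvd_map (Int.castRingHom ℂ) Int.cast_injective hmon, hN, hmap, hneg]
    exact ⟨(-1) ^ g * P, by ring⟩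
  obtain ⟨Z, rfl⟩ := hdvd
  refine (mem_lifts _).2 ⟨(-1) ^ g * Z, ?_⟩
  rw [Polynomial.map_mul, hmap, hneg] at hN
  have hne : ((X ^ a - 1) ^ g : ℂ[X]) ≠ 0 := hmap ▸ (hmon.map _).ne_zero
  have h2 : Z.map (Int.castRingHom ℂ) = (-1) ^ g * P :=
    mul_left_cancel₀ hne (hN.trans (by ring))
  rw [Polynomial.map_mul, h2, ← mul_assoc]
  simp [← mul_pow]

end CyclotomicFunctionField
end

open CyclotomicFunctionField in
theorem proposition3p1 (F : Type*) [Field F] [Fintype F] (m : F[X]) (hm : m.Monic) :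
    (algebraMap ℂ[X] (RatFunc ℂ) (JMinus m) =
      ∏ᶠ Q ∈ primeDivisors m,
        (1 - RatFunc.X ^ (residueDegree (cyclotomicField m) Q * Q.natDegree)) ^
            numPrimesOver (cyclotomicField m) Q /
          (1 - RatFunc.X ^ (residueDegree (maximalRealSubfield m) Q * Q.natDegree)) ^
            numPrimesOver (maximalRealSubfield m) Q) ∧
    (∃ P : ℤ[X], P.map (Int.castRingHom ℂ) = JMinus m) ∧
    (IsPrimePow m → JMinus m = 1) := by
  have hQ : ∀ Q ∈ primeDivisors m,
      residueDegree (maximalRealSubfield m) Q * Q.natDegree ≠ 0 ∧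
      (1 - X ^ (residueDegree (maximalRealSubfield m) Q * Q.natDegree)) ^
          numPrimesOver (maximalRealSubfield m) Q *
        ∏ᶠ χ ∈ oddChars m, (1 - C (χ.eval Q) * X ^ Q.natDegree) =
      (1 - X ^ (residueDegree (cyclotomicField m) Q * Q.natDegree)) ^
        numPrimesOver (cyclotomicField m) Q := by
    intro Q hQ
    obtain ⟨h1, h2, h3⟩ := finprod_eulerFactors_eq hm hQ
    -- A zero exponent would make the base of the denominator 1 - X^0 = 0.
    refine ⟨mul_ne_zero h3 hQ.2.1.natDegree_pos.ne', ?_⟩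
    rw [← h1, ← h2, finprod_evenChars_mul_oddChars hm.ne_zero]
  rw [JMinus_eq_finprod hm.ne_zero]
  refine ⟨?_, ?_, fun h => ?_⟩
  · rw [← MonoidHom.coe_coe, MonoidHom.map_finprod_mem _ _ (primeDivisors_finite hm.ne_zero)]
    refine finprod_mem_congr rfl fun Q h => ?_
    obtain ⟨ha, hmul⟩ := hQ Q h
    have hne : (1 - X ^ (residueDegree (maximalRealSubfield m) Q * Q.natDegree) : ℂ[X]) ≠ 0 := by
      rw [← neg_ne_zero, neg_sub]
      exact (monic_X_pow_sub_C 1 ha).ne_zero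
    have hne' := RatFunc.algebraMap_ne_zero (pow_ne_zero
      (numPrimesOver (maximalRealSubfield m) Q) hne)
    have h2 := congrArg (algebraMap ℂ[X] (RatFunc ℂ)) hmul
    rw [map_mul] at h2
    simp only [map_pow, map_sub, map_one, RatFunc.algebraMap_X] at h2 hne'
    rw [eq_div_iff hne', mul_comm]
    exact h2
  · rw [← mem_lifts]
    refine finprod_mem_induction (· ∈ lifts (Int.castRingHom ℂ)) (one_mem _)
      (fun _ _ => mul_mem) fun Q h => ?_
    obtain ⟨ha, hmul⟩ := hQ Q h
    refine mem_lifts_of_one_sub_X_pow_mul_mem_lifts ha (P := ∏ᶠ χ ∈ oddChars m, _)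
      (g := numPrimesOver (maximalRealSubfield m) Q) ?_
    rw [hmul]
    exact (mem_lifts _).2 ⟨(1 - X ^ (residueDegree (cyclotomicField m) Q * Q.natDegree)) ^
        numPrimesOver (cyclotomicField m) Q, by simp⟩
  · rw [← JMinus_eq_finprod hm.ne_zero, JMinus_eq_one_of_isPrimePow h]
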